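/- Let $(R,m,k)$ be a regular local ring for which the order ideal conjecture holds, that is: for every finitely generated $R$-module $M$ of finite projective dimension, every $i>0$ and every minimal generator $\beta$ of the $i$-th syzygy $\operatorname{Syz}^i(M)$ of $M$ in a minimal free resolution, the order ideal $\{f(\beta) : f\in\operatorname{Hom}_R(\operatorname{Syz}^i(M),R)\}$ has grade at least $i$ (the unit ideal having grade $\infty$). Let $I$ be any proper ideal of $R$ of codimension (height) $d$, and let $\Omega=\operatorname{Ext}^d_R(R/I,R)$ be the canonical module of $R/I$. Then the $d$-th syzygy $\operatorname{Syz}^d(\Omega)$ of $\Omega$ in a minimal free resolution of $\Omega$ over $R$ (with $\operatorname{Syz}^0(\Omega)=\Omega$) has a nonzero free direct summand, i.e. $\operatorname{Syz}^d(\Omega)\cong R\oplus N$ for some $R$-module $N$. -/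

import Mathlib

universe u v

/-- A minimal free resolution of a module `M` over a local ring `(R, m)`:
an exact complex `⋯ → F₂ → F₁ → F₀ → M → 0` with `Fₙ = R ^ rank n` of finite rank and
`d (Fₙ₊₁) ⊆ m Fₙ` for all `n`. -/
structure MinimalFreeResolution (R : Type u) [CommRing R] [IsLocalRing R]
    (M : Type v) [AddCommGroup M] [Module R M] where
  rank : ℕ → ℕ
  d : ∀ n : ℕ, (Fin (rank (n + 1)) → R) →ₗ[R] (Fin (rank n) → R)
  aug : (Fin (rank 0) → R) →ₗ[R] M
  aug_surjective : Function.Surjective aug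
  exact_aug : Function.Exact (d 0) aug
  exact_d : ∀ n : ℕ, Function.Exact (d (n + 1)) (d n)
  minimal : ∀ n : ℕ, LinearMap.range (d n) ≤
    IsLocalRing.maximalIdeal R • (⊤ : Submodule R (Fin (rank n) → R))

/-- The `i`-th (minimal) syzygy of `M`: it is `M` for `i = 0`, and the image of
`Fᵢ → Fᵢ₋₁` for `i ≥ 1`. -/
def MinimalFreeResolution.syz {R : Type u} [CommRing R] [IsLocalRing R]
    {M : Type u} [AddCommGroup M] [Module R M] (L : MinimalFreeResolution R M) :
    ℕ → ModuleCat.{u} R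
  | 0 => ModuleCat.of R M
  | i + 1 => ModuleCat.of R (LinearMap.range (L.d i))

/-- A minimal generator of a finitely generated module `N` over a local ring `(R, m)`, i.e. a
member of some minimal generating system; by Nakayama these are the elements of `N` outside
`m N`. -/
def IsMinimalGenerator (R : Type u) [CommRing R] [IsLocalRing R]
    {N : Type v} [AddCommGroup N] [Module R N] (b : N) : Prop :=
  b ∉ IsLocalRing.maximalIdeal R • (⊤ : Submodule R N)

/-- The order ideal `{f b | f ∈ Hom_R(N, R)}` of an element `b` of a module `N`. -/
def orderIdeal (R : Type u) [CommRing R] {N : Type v} [AddCommGroup N] [Module R N]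
    (b : N) : Ideal R :=
  LinearMap.range (LinearMap.applyₗ (R := R) (M₂ := R) b)

/-- The grade of an ideal `a`: the supremum of the lengths of the `R`-sequences in `a`.
Weakly regular sequences in a proper ideal of a local ring are regular; for the unit ideal
this gives the usual convention that the grade is infinite. -/
noncomputable def idealGrade {R : Type u} [CommRing R] (a : Ideal R) : ℕ∞ :=
  ⨆ rs : {l : List R // RingTheory.Sequence.IsWeaklyRegular R l ∧ ∀ r ∈ l, r ∈ a},
    (rs.1.length : ℕ∞)

/-- The order ideal conjecture for a (Noetherian) local ring `R`: for every finitely generated `R`-module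
`M` of finite projective dimension and every `i > 0`, the order ideal of every minimal generator
of the `i`-th syzygy of `M` has grade at least `i`. -/
def OrderIdealConjecture (R : Type u) [CommRing R] [IsLocalRing R] : Prop :=
  ∀ (M : Type u) [AddCommGroup M] [Module R M] [Module.Finite R M],
    CategoryTheory.projectiveDimension (ModuleCat.of R M) ≠ ⊤ →
    ∀ (L : MinimalFreeResolution R M) (i : ℕ), 0 < i →
    ∀ b : L.syz i, IsMinimalGenerator R b → (i : ℕ∞) ≤ idealGrade (orderIdeal R b)

/-- The canonical module `Ext_R^d(R/I, R)`, `d = height I`, of the quotient `R/I` of a regular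
local ring `R` by a proper ideal `I`, as an `R`-module. -/
abbrev canonicalModule {R : Type u} [CommRing R] (I : Ideal R) : Type u :=
  CategoryTheory.Abelian.Ext (ModuleCat.of R (R ⧸ I)) (ModuleCat.of R R) I.height.toNat

/-- `N` has a free summand: `N = p ⊕ q` with `p` free of rank one. -/
def HasFreeSummand (R : Type u) [CommRing R] (N : Type v) [AddCommGroup N] [Module R N] : Prop :=
  ∃ p q : Submodule R N, IsCompl p q ∧ Nonempty (p ≃ₗ[R] R)

/-- Minimal free covers exist. -/
theorem exists_minimal_free_cover (R : Type u) [CommRing R] [IsLocalRing R]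
    (M : Type v) [AddCommGroup M] [Module R M] [Module.Finite R M] :
    ∃ (n : ℕ) (f : (Fin n → R) →ₗ[R] M), Function.Surjective f ∧
      LinearMap.ker f ≤ IsLocalRing.maximalIdeal R • (⊤ : Submodule R (Fin n → R)) := by
  let k := IsLocalRing.ResidueField R
  let b := Module.finBasis k (TensorProduct R k M)
  have hb : ∀ i, ∃ m : M, (1 : k) ⊗ₜ[R] m = b i := fun i =>
    (TensorProduct.mk_surjective R M k Ideal.Quotient.mk_surjective) (b i)
  choose g hg using hb
  refine ⟨_, Fintype.linearCombination R g, ?_, ?_⟩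
  · rw [← LinearMap.range_eq_top, Fintype.range_linearCombination]
    exact IsLocalRing.span_eq_top_of_tmul_eq_basis g b hg
  · intro x hx
    have h1 : ∑ i, x i • g i = 0 := by
      simpa [Fintype.linearCombination_apply] using hx
    have h2 : ∑ i, IsLocalRing.residue R (x i) • b i = 0 := by
      have h3 := congrArg (fun m => (1 : k) ⊗ₜ[R] m) h1
      simp only [TensorProduct.tmul_sum, TensorProduct.tmul_zero, TensorProduct.tmul_smul, hg]
        at h3
      rw [← h3]
      exact Finset.sum_congr rfl fun i _ => algebraMap_smul k (x i) (b i)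
    have h4 := Fintype.linearIndependent_iff.mp b.linearIndependent _ h2
    rw [pi_eq_sum_univ' x]
    refine Submodule.sum_mem _ fun i _ => Submodule.smul_mem_smul ?_ trivial
    exact (IsLocalRing.residue_eq_zero_iff _).mp (h4 i)

/-- Every finitely generated module over a Noetherian local ring has a minimal free
resolution. -/
theorem MinimalFreeResolution.nonempty (R : Type u) [CommRing R] [IsLocalRing R]
    [IsNoetherianRing R] (M : Type v) [AddCommGroup M] [Module R M] [Module.Finite R M] :
    Nonempty (MinimalFreeResolution R M) := by
  obtain ⟨n₀, f₀, hf₀, hk₀⟩ := exists_minimal_free_cover R M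
  have step : ∀ s : (Σ n : ℕ, Submodule R (Fin n → R)), ∃ (n : ℕ)
      (f : (Fin n → R) →ₗ[R] (Fin s.1 → R)), LinearMap.range f = s.2 ∧
      LinearMap.ker f ≤ IsLocalRing.maximalIdeal R • (⊤ : Submodule R (Fin n → R)) := by
    intro s
    obtain ⟨n, f, hf, hk⟩ := exists_minimal_free_cover R s.2
    refine ⟨n, s.2.subtype ∘ₗ f, ?_, ?_⟩
    · rw [LinearMap.range_comp, LinearMap.range_eq_top.mpr hf, Submodule.map_top,
        Submodule.range_subtype]
    · rwa [LinearMap.ker_comp, Submodule.ker_subtype]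
  choose r f hr hk using step
  let st : ℕ → (Σ n : ℕ, Submodule R (Fin n → R)) := fun n =>
    Nat.rec ⟨n₀, LinearMap.ker f₀⟩ (fun _ s => ⟨r s, LinearMap.ker (f s)⟩) n
  have hst : ∀ n, (st n).2 ≤
      IsLocalRing.maximalIdeal R • (⊤ : Submodule R (Fin (st n).1 → R)) := by
    intro n
    cases n with
    | zero => exact hk₀
    | succ n => exact hk (st n)
  exact ⟨{
    rank := fun n => (st n).1
    d := fun n => f (st n)
    aug := f₀
    aug_surjective := hf₀
    exact_aug := LinearMap.exact_iff.mpr (hr (st 0)).symm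
    exact_d := fun n => LinearMap.exact_iff.mpr (hr (st (n + 1))).symm
    minimal := fun n => (hr (st n)).le.trans (hst n) }⟩

/-! Let `d = k + 1` be the height of `I`, the case `d = 0` being `I = 0`, `Ω ≅ R`. Splice a minimal
resolution `G` of `I` with `R → R/I` and dualize: `R → G₀* → G₁* → ⋯`. Since `Ext^i(R/I, R) = 0` for
`i < d` (`subsingleton_ext_quotient_of_lt_height`), this is exact at `G_j*` for `j < k`. The first
coboundary module `B₀` is free of rank one on the functional `g : G₀ → I ⊆ R`, and `Ω = Z_k / B_k`,
where `Z_k` is a second syzygy of `W = coker (G_k* → G_{k+1}*)`.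

Apply the horseshoe lemma `k` times to `0 → B_k → Z_k → Ω → 0`
(`MinimalFreeResolution.exists_extension_syz`). The result is `0 → B₀ → Y → Syz^k(Ω) → 0`, with `Y`
a `(d+1)`-st syzygy of `W` inside a free module `C`. The generator `e` of `B₀` lands in `I C`,
because `g` takes values in `I`.

Claim: `e ∈ m Y`. Otherwise its order ideal has grade at least `d + 1`, by the conjecture and
Schanuel's lemma (`OrderIdealConjecture.le_idealGrade_of_isNthSyzygy`). But at a prime `P ⊇ I` of
height `d` every `d`-th syzygy becomes free, so `Y → C` splits there; as `e ∈ I C`, the order ideal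
lies in `P` and has grade at most `d` (`idealGrade_orderIdeal_le_height`).

Finally, lifting the free cover of `Syz^k(Ω)` to `Y` induces `Syz^d(Ω) → B₀ ≅ R`, and `e ∈ m Y`
forces this map to take a unit value, which splits off a copy of `R`
(`hasFreeSummand_of_mem_maximalIdeal_smul`). -/

section

open CategoryTheory IsLocalRing

/-! ### Projective dimension modulo a regular element. -/

section ShortExact

variable {R : Type u} [CommRing R] {M N P : Type u} [AddCommGroup M] [Module R M]
  [AddCommGroup N] [Module R N] [AddCommGroup P] [Module R P]

/-- The short complex of modules attached to an exact pair of linear maps. -/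
abbrev exactPair {f : M →ₗ[R] N} {g : N →ₗ[R] P} (h : Function.Exact f g) :
    ShortComplex (ModuleCat.{u} R) :=
  ShortComplex.mk (ModuleCat.ofHom f) (ModuleCat.ofHom g)
    (ModuleCat.hom_ext (LinearMap.ext fun x => h.apply_apply_eq_zero x))

theorem exactPair_shortExact {f : M →ₗ[R] N} {g : N →ₗ[R] P} (h : Function.Exact f g)
    (hf : Function.Injective f) (hg : Function.Surjective g) : (exactPair h).ShortExact where
  exact := (ShortComplex.ShortExact.moduleCat_exact_iff_function_exact _).mpr h
  mono_f := (ModuleCat.mono_iff_injective _).mpr hf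
  epi_g := (ModuleCat.epi_iff_surjective _).mpr hg

end ShortExact

theorem module_projective_iff_hasProjectiveDimensionLE_zero {R : Type u} [CommRing R] (M : Type u)
    [AddCommGroup M] [Module R M] :
    HasProjectiveDimensionLE (ModuleCat.of R M) 0 ↔ Module.Projective R M := by
  rw [← CategoryTheory.projective_iff_hasProjectiveDimensionLE_zero,
    ← IsProjective.iff_projective]

theorem free_iff_hasProjectiveDimensionLE_zero {R : Type u} [CommRing R] [IsLocalRing R]
    [IsNoetherianRing R] (M : Type u) [AddCommGroup M] [Module R M] [Module.Finite R M] :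
    HasProjectiveDimensionLE (ModuleCat.of R M) 0 ↔ Module.Free R M := by
  rw [module_projective_iff_hasProjectiveDimensionLE_zero]
  have := Module.finitePresentation_of_finite R M
  exact ⟨fun h => Module.free_of_flat_of_isLocalRing, fun h => inferInstance⟩

theorem isSMulRegular_of_free {R : Type u} [CommRing R] {x : R} (hx : IsSMulRegular R x)
    (M : Type v) [AddCommGroup M] [Module R M] [Module.Free R M] : IsSMulRegular M x := by
  let b := Module.Free.chooseBasis R M
  refine (LinearEquiv.isSMulRegular_congr b.repr x).mpr ?_
  intro f g h
  ext i
  exact hx (by simpa using! DFunLike.congr_fun h i)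

theorem isLocalRing_quotient_span_singleton {R : Type u} [CommRing R] [IsLocalRing R] {x : R}
    (hx : x ∈ maximalIdeal R) : IsLocalRing (R ⧸ Ideal.span {x}) := by
  have : Nontrivial (R ⧸ Ideal.span {x}) := Ideal.Quotient.nontrivial_iff.mpr fun h =>
    (mem_maximalIdeal x).mp hx (Ideal.span_singleton_eq_top.mp h)
  exact IsLocalRing.of_surjective' (Ideal.Quotient.mk _) Ideal.Quotient.mk_surjective

/-- Reduction modulo `x` keeps a presentation `0 → K → F → M → 0` exact when `x` is regular on `M`,
and `x` is again regular on `K ⊆ F`, so both dimensions drop together until the free case. -/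
theorem hasProjectiveDimensionLE_quotSMulTop_iff {R : Type u} [CommRing R] [IsLocalRing R]
    [IsNoetherianRing R] {x : R} (hxm : x ∈ maximalIdeal R) (hx : IsSMulRegular R x) (n : ℕ)
    (M : Type u) [AddCommGroup M] [Module R M] [Module.Finite R M] (hM : IsSMulRegular M x) :
    HasProjectiveDimensionLE (ModuleCat.of (R ⧸ Ideal.span {x}) (QuotSMulTop x M)) n ↔
      HasProjectiveDimensionLE (ModuleCat.of R M) n := by
  have := isLocalRing_quotient_span_singleton hxm
  have hfin (N : Type u) [AddCommGroup N] [Module R N] [Module.Finite R N] :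
      Module.Finite (R ⧸ Ideal.span {x}) (QuotSMulTop x N) :=
    Module.Finite.of_restrictScalars_finite R _ _
  induction n generalizing M with
  | zero =>
    have := hfin M
    have := Module.finitePresentation_of_finite R M
    rw [free_iff_hasProjectiveDimensionLE_zero, free_iff_hasProjectiveDimensionLE_zero]
    refine Module.free_quotSMulTop_iff_free R M ?_ hM
    rwa [IsLocalRing.jacobson_eq_maximalIdeal ⊥ bot_ne_top]
  | succ n ih =>
    obtain ⟨F, _, _, _, _, f, hf⟩ := Module.exists_finite_presentation R M
    have hF := isSMulRegular_of_free hx F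
    let K := LinearMap.ker f
    have hK : IsSMulRegular K x := hF.submodule K
    let g := K.subtype
    have hgf : Function.Exact g f := LinearMap.exact_subtype_ker_map f
    have h0 : Function.Exact (0 : PUnit.{u+1} →ₗ[R] K) g :=
      (LinearMap.exact_zero_iff_injective _ _).mpr K.injective_subtype
    have hsurj : Function.Surjective (algebraMap R (R ⧸ Ideal.span {x})) :=
      Ideal.Quotient.mk_surjective
    have e1 := QuotSMulTop.map_exact x hgf hf
    -- The four-term sequence `0 → K → F → M` encodes injectivity of `K/xK → F/xF`; this is where
    -- regularity of `x` on `M` enters.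
    have e0 := QuotSMulTop.map_first_exact_on_four_term_exact_of_isSMulRegular_last h0 hgf hM
    have einj : Function.Injective (QuotSMulTop.map x g) := by
      rw [map_zero] at e0
      exact (LinearMap.exact_zero_iff_injective _ _).mp e0
    have e1' : Function.Exact ((QuotSMulTop.map x g).extendScalarsOfSurjective hsurj)
      ((QuotSMulTop.map x f).extendScalarsOfSurjective hsurj) := e1
    have S1 := exactPair_shortExact hgf K.injective_subtype hf
    have S2 := exactPair_shortExact e1' einj (QuotSMulTop.map_surjective x hf)
    have p1 : Projective (exactPair hgf).X₂ :=
      IsProjective.iff_projective _ |>.mp (inferInstanceAs (Module.Projective R F))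
    have p2 : Projective (exactPair e1').X₂ :=
      IsProjective.iff_projective _ |>.mp
        (inferInstanceAs (Module.Projective (R ⧸ Ideal.span {x}) (QuotSMulTop x F)))
    exact (S2.hasProjectiveDimensionLT_X₃_iff n p2).trans
      ((ih K hK).trans (S1.hasProjectiveDimensionLT_X₃_iff n p1).symm)

end

/-! ### Bounding finite projective dimension by the Krull dimension. -/

section

open CategoryTheory IsLocalRing

/-- Zero divisors form the union of the finitely many associated primes. By prime avoidance, if `m`
consists of zero divisors then `m` is itself associated, hence the annihilator of an element. -/
theorem exists_isSMulRegular_or_exists_annihilator {R : Type u} [CommRing R] [IsLocalRing R]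
    [IsNoetherianRing R] :
    (∃ x ∈ maximalIdeal R, IsSMulRegular R x) ∨
      ∃ a : R, a ≠ 0 ∧ ∀ x ∈ maximalIdeal R, a * x = 0 := by
  by_cases h : ∃ x ∈ maximalIdeal R, IsSMulRegular R x
  · exact .inl h
  right
  push Not at h
  have hsub : (maximalIdeal R : Set R) ⊆ ⋃ p ∈ associatedPrimes R R, (p : Set R) := by
    rw [biUnion_associatedPrimes_eq_compl_regular R R]
    exact fun r hr => h r hr
  obtain ⟨p, hp, hmp⟩ := (Ideal.subset_union_prime_finite (associatedPrimes.finite R R)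
    (f := id) 0 0 fun q hq _ _ => IsAssociatedPrime.isPrime hq).mp hsub
  have hpm : p = maximalIdeal R :=
    le_antisymm (le_maximalIdeal (IsAssociatedPrime.isPrime hp).ne_top) hmp
  obtain ⟨hprime, a, ha⟩ := isAssociatedPrime_iff.mp (AssociatedPrimes.mem_iff.mp hp)
  refine ⟨a, ?_, fun x hx => ?_⟩
  · rintro rfl
    refine hprime.ne_top ((Ideal.eq_top_iff_one _).mpr ?_)
    rw [ha]; simp [Submodule.mem_colon_singleton]
  · rw [← hpm, ha] at hx
    simpa [Submodule.mem_colon_singleton, mul_comm] using hx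

theorem hasProjectiveDimensionLE_of_syzygy {R : Type u} [CommRing R] {K F M : Type u}
    [AddCommGroup K] [Module R K] [AddCommGroup F] [Module R F] [AddCommGroup M] [Module R M]
    [Module.Projective R F] {g : K →ₗ[R] F} {f : F →ₗ[R] M} (h : Function.Exact g f)
    (hg : Function.Injective g) (hf : Function.Surjective f) (n : ℕ) :
    HasProjectiveDimensionLE (ModuleCat.of R M) (n + 1) ↔
      HasProjectiveDimensionLE (ModuleCat.of R K) n := by
  have p1 : Projective (exactPair h).X₂ :=
    IsProjective.iff_projective _ |>.mp (inferInstanceAs (Module.Projective R F))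
  exact (exactPair_shortExact h hg hf).hasProjectiveDimensionLT_X₃_iff n p1

/-- The depth zero case: `a` kills `m F`, hence the kernel of a minimal cover. By induction that
kernel is free, and a nonzero free module is faithful, so the kernel vanishes. -/
theorem free_of_hasProjectiveDimensionLE_of_annihilator {R : Type u} [CommRing R] [IsLocalRing R]
    [IsNoetherianRing R] {a : R} (ha : a ≠ 0) (ham : ∀ x ∈ maximalIdeal R, a * x = 0) (k : ℕ)
    (M : Type u) [AddCommGroup M] [Module R M] [Module.Finite R M]
    (h : HasProjectiveDimensionLE (ModuleCat.of R M) k) : Module.Free R M := by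
  induction k generalizing M with
  | zero => exact (free_iff_hasProjectiveDimensionLE_zero M).mp h
  | succ k ih =>
    obtain ⟨n, f, hf, hker⟩ := exists_minimal_free_cover R M
    have hK := ih (LinearMap.ker f) ((hasProjectiveDimensionLE_of_syzygy
      (LinearMap.exact_subtype_ker_map f) (Submodule.subtype_injective _) hf k).mp h)
    have hzero : ∀ y ∈ maximalIdeal R • (⊤ : Submodule R (Fin n → R)), a • y = 0 := by
      intro y hy
      refine Submodule.smul_induction_on hy (fun r hr z _ => ?_) fun y z hy hz => ?_
      · rw [smul_smul, ham r hr, zero_smul]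
      · rw [smul_add, hy, hz, add_zero]
    have hsub : Subsingleton (LinearMap.ker f) := by
      by_contra hns
      have := not_subsingleton_iff_nontrivial.mp hns
      have hmem : a ∈ Module.annihilator R (LinearMap.ker f) :=
        Module.mem_annihilator.mpr fun y => Subtype.ext (hzero y (hker y.2))
      rw [Module.annihilator_eq_bot.mpr inferInstance] at hmem
      exact ha hmem
    have hinj : Function.Injective f :=
      LinearMap.ker_eq_bot.mp ((Submodule.subsingleton_iff_eq_bot).mp hsub)
    exact Module.Free.of_equiv (LinearEquiv.ofBijective f ⟨hinj, hf⟩)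

theorem eq_natCast_of_add_one_eq {a : WithBot ℕ∞} {n : ℕ} (h : a + 1 = n + 1) : a = n :=
  le_antisymm (ENat.WithBot.add_le_add_one_right_iff.mp h.le)
    (ENat.WithBot.add_le_add_one_right_iff.mp h.ge)

/-- A form of the Auslander–Buchsbaum bound: finite projective dimension is at most the Krull
dimension. -/
theorem hasProjectiveDimensionLE_ringKrullDim (n : ℕ) {R : Type u} [CommRing R] [IsLocalRing R]
    [IsNoetherianRing R] (hn : ringKrullDim R = n) (M : Type u) [AddCommGroup M] [Module R M]
    [Module.Finite R M] (k : ℕ) (h : HasProjectiveDimensionLE (ModuleCat.of R M) k) :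
    HasProjectiveDimensionLE (ModuleCat.of R M) n := by
  induction n generalizing R M with
  | zero =>
    rcases exists_isSMulRegular_or_exists_annihilator (R := R) with ⟨x, hxm, hx⟩ | ⟨a, ha, ham⟩
    · have := isLocalRing_quotient_span_singleton hxm
      have h1 := ringKrullDim_quotient_span_singleton_succ_eq_ringKrullDim hx hxm
      rw [hn] at h1
      have h2 : (0 : WithBot ℕ∞) ≤ ringKrullDim (R ⧸ Ideal.span {x}) := ringKrullDim_nonneg_of_nontrivial
      have h3 : (0 : WithBot ℕ∞) + 1 ≤ ((0 : ℕ) : WithBot ℕ∞) := by rw [← h1]; gcongr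
      norm_num at h3
    · exact (free_iff_hasProjectiveDimensionLE_zero M).mpr
        (free_of_hasProjectiveDimensionLE_of_annihilator ha ham k M h)
  | succ n ih =>
    rcases exists_isSMulRegular_or_exists_annihilator (R := R) with ⟨x, hxm, hx⟩ | ⟨a, ha, ham⟩
    · have := isLocalRing_quotient_span_singleton hxm
      have h1 := ringKrullDim_quotient_span_singleton_succ_eq_ringKrullDim hx hxm
      have h2 : ringKrullDim (R ⧸ Ideal.span {x}) = n := by
        rw [hn, Nat.cast_add, Nat.cast_one] at h1
        exact eq_natCast_of_add_one_eq h1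
      -- `x` need not be regular on `M`, but it is on a first syzygy. Passing to the syzygy and
      -- cutting by `x` cost one unit of projective and of Krull dimension respectively.
      obtain ⟨F, _, _, _, _, f, hf⟩ := Module.exists_finite_presentation R M
      have hsyz := hasProjectiveDimensionLE_of_syzygy (LinearMap.exact_subtype_ker_map f)
        (Submodule.subtype_injective _) hf
      have hK : IsSMulRegular (LinearMap.ker f) x := (isSMulRegular_of_free hx F).submodule _
      have hk : HasProjectiveDimensionLE (ModuleCat.of R M) (k + 1) :=
        hasProjectiveDimensionLT_of_ge _ (k + 1) (k + 1 + 1) (by omega)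
      have : Module.Finite (R ⧸ Ideal.span {x}) (QuotSMulTop x (LinearMap.ker f)) :=
        Module.Finite.of_restrictScalars_finite R _ _
      rw [hsyz, ← hasProjectiveDimensionLE_quotSMulTop_iff hxm hx n _ hK]
      exact ih h2 _ ((hasProjectiveDimensionLE_quotSMulTop_iff hxm hx k _ hK).mpr
        ((hsyz k).mp hk))
    · have h0 := (free_iff_hasProjectiveDimensionLE_zero M).mpr
        (free_of_hasProjectiveDimensionLE_of_annihilator ha ham k M h)
      exact hasProjectiveDimensionLT_of_ge _ (0 + 1) (n + 1 + 1) (by omega)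

end

/-! ### Regular local rings: domains, finite global dimension, regular sequences of full length. -/

section

open CategoryTheory IsLocalRing

theorem spanFinrank_maximalIdeal_quotient_span_singleton {R : Type u} [CommRing R] [IsLocalRing R]
    [IsNoetherianRing R] {x : R} (hx : x ∈ maximalIdeal R) (hx2 : x ∉ maximalIdeal R ^ 2)
    [IsLocalRing (R ⧸ Ideal.span {x})] :
    (maximalIdeal (R ⧸ Ideal.span {x})).spanFinrank + 1 ≤ (maximalIdeal R).spanFinrank := by
  classical
  have fg : (maximalIdeal R).FG := (maximalIdeal R).fg_of_isNoetherianRing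
  have hfin := Submodule.FG.finite_generators fg
  set s := hfin.toFinset with hs
  have hspan : Submodule.span R (s : Set R) = maximalIdeal R := by
    rw [hs, Set.Finite.coe_toFinset, Submodule.span_generators]
  have hcard : s.card = (maximalIdeal R).spanFinrank := by
    rw [← Submodule.FG.generators_ncard fg, Set.ncard_eq_toFinset_card _ hfin]
  have hmem : ∀ i ∈ s, i ∈ maximalIdeal R := fun i hi => hspan ▸ Submodule.subset_span hi
  obtain ⟨a, -, ha⟩ := Submodule.mem_span_finset.mp (hspan.symm ▸ hx)
  -- As `x ∉ m²`, some coefficient is a unit; modulo `x` the corresponding generator is redundant.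
  obtain ⟨i, hi, hunit⟩ : ∃ i ∈ s, IsUnit (a i) := by
    by_contra! hcon
    refine hx2 (ha ▸ Ideal.sum_mem _ fun i hi => ?_)
    rw [pow_two]
    exact Ideal.mul_mem_mul ((mem_maximalIdeal _).mpr (hcon i hi)) (hmem i hi)
  let π := Ideal.Quotient.mk (Ideal.span {x})
  have hπ : Function.Surjective π := Ideal.Quotient.mk_surjective
  have hπx : π x = 0 := Ideal.Quotient.eq_zero_iff_mem.mpr (Ideal.mem_span_singleton_self x)
  have hle : maximalIdeal (R ⧸ Ideal.span {x}) ≤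
      Submodule.span (R ⧸ Ideal.span {x}) (((s.erase i).image π : Finset _) : Set _) := by
    intro y hy
    obtain ⟨z, rfl⟩ := hπ y
    have hz : z ∈ maximalIdeal R := by
      by_contra hz
      exact (mem_maximalIdeal _).mp hy ((notMem_maximalIdeal.mp hz).map π)
    have key : ∀ j ∈ s, π j ∈ Submodule.span (R ⧸ Ideal.span {x})
        (((s.erase i).image π : Finset _) : Set (R ⧸ Ideal.span {x})) := by
      have herase : ∀ j ∈ s.erase i, π j ∈ Submodule.span (R ⧸ Ideal.span {x})
          (((s.erase i).image π : Finset _) : Set (R ⧸ Ideal.span {x})) := fun j hj =>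
        Submodule.subset_span (Finset.mem_coe.mpr (Finset.mem_image_of_mem π hj))
      intro j hj
      by_cases hji : j = i
      · subst hji
        rw [← Finset.add_sum_erase _ _ hi] at ha
        have h1 := congrArg π ha
        rw [hπx, map_add, map_sum, smul_eq_mul, map_mul, add_eq_zero_iff_eq_neg] at h1
        rw [← Ideal.unit_mul_mem_iff_mem _ (hunit.map π), h1]
        refine neg_mem (Submodule.sum_mem _ fun l hl => ?_)
        rw [smul_eq_mul, map_mul]
        exact Submodule.smul_mem _ (π (a l)) (herase l hl)
      · exact herase j (Finset.mem_erase.mpr ⟨hji, hj⟩)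
    obtain ⟨b, -, hb⟩ := Submodule.mem_span_finset.mp (hspan.symm ▸ hz)
    rw [← hb, map_sum]
    refine Submodule.sum_mem _ fun l hl => ?_
    rw [smul_eq_mul, map_mul]
    exact Submodule.smul_mem _ (π (b l)) (key l hl)
  have heq : maximalIdeal (R ⧸ Ideal.span {x}) =
      Submodule.span (R ⧸ Ideal.span {x}) (((s.erase i).image π : Finset _) : Set _) := by
    refine le_antisymm hle (Submodule.span_le.mpr ?_)
    intro y hy
    obtain ⟨j, hj, rfl⟩ := Finset.mem_image.mp (Finset.mem_coe.mp hy)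
    have hjm := hmem j (Finset.mem_of_mem_erase hj)
    have : IsLocalHom π := IsLocalHom.of_surjective π hπ
    exact (mem_maximalIdeal _).mpr fun hu => (mem_maximalIdeal _).mp hjm (isUnit_of_map_unit π j hu)
  rw [heq, ← hcard, ← Finset.card_erase_add_one hi]
  have h1 := Submodule.spanFinrank_span_le_ncard_of_finite (R := R ⧸ Ideal.span {x})
    ((s.erase i).image π).finite_toSet
  rw [Set.ncard_coe_finset] at h1
  have h2 := Finset.card_image_le (s := s.erase i) (f := π)
  omega

theorem exists_mem_maximalIdeal_notMem_sq_notMem_minimalPrimes {R : Type u} [CommRing R]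
    [IsLocalRing R] [IsNoetherianRing R] {n : ℕ} (hn : ringKrullDim R = (n + 1 : ℕ)) :
    ∃ x ∈ maximalIdeal R, x ∉ maximalIdeal R ^ 2 ∧ ∀ p ∈ minimalPrimes R, x ∉ p := by
  have hht : (maximalIdeal R).height = (n + 1 : ℕ) := by
    rw [← maximalIdeal_height_eq_ringKrullDim] at hn
    exact_mod_cast hn
  have hmin : maximalIdeal R ∉ minimalPrimes R := by
    intro h
    rw [Ideal.height_eq_zero_iff.mpr h] at hht
    norm_cast at hht
  by_contra! hcon
  have hsub : (maximalIdeal R : Set R) ⊆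
      ⋃ p ∈ insert (maximalIdeal R ^ 2) (minimalPrimes R), (p : Set R) := by
    intro x hx
    by_cases h2 : x ∈ maximalIdeal R ^ 2
    · exact Set.mem_biUnion (Set.mem_insert _ _) h2
    · obtain ⟨p, hp, hxp⟩ := hcon x hx h2
      exact Set.mem_biUnion (Set.mem_insert_of_mem _ hp) hxp
  -- Prime avoidance tolerates up to two non-prime ideals; here only `m²` may fail to be prime.
  obtain ⟨p, hp, hmp⟩ := (Ideal.subset_union_prime_finite
    ((minimalPrimes.finite_of_isNoetherianRing R).insert _) (f := id)
    (maximalIdeal R ^ 2) (maximalIdeal R ^ 2) (by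
      rintro q (rfl | hq) h1 -
      · exact absurd rfl h1
      · exact Ideal.IsMinimalPrime.isPrime hq)).mp hsub
  rcases hp with rfl | hp
  · have hbot : maximalIdeal R = ⊥ :=
      Submodule.eq_bot_of_le_smul_of_le_jacobson_bot (maximalIdeal R) _
        (maximalIdeal R).fg_of_isNoetherianRing (by simpa [pow_two] using hmp)
        (maximalIdeal_le_jacobson _)
    have hfield := isField_iff_maximalIdeal_eq.mpr hbot
    rw [ringKrullDim_eq_zero_of_isField hfield] at hn
    norm_cast at hn
  · have := Ideal.IsMinimalPrime.isPrime hp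
    have heq : p = maximalIdeal R := le_antisymm (le_maximalIdeal this.ne_top) hmp
    exact hmin (heq ▸ hp)

theorem isRegularLocalRing_quotient_span_singleton {R : Type u} [CommRing R]
    [IsRegularLocalRing R] {n : ℕ} (hn : ringKrullDim R = (n + 1 : ℕ)) {x : R}
    (hx : x ∈ maximalIdeal R) (hx2 : x ∉ maximalIdeal R ^ 2) :
    IsRegularLocalRing (R ⧸ Ideal.span {x}) ∧ ringKrullDim (R ⧸ Ideal.span {x}) = n := by
  have := isLocalRing_quotient_span_singleton hx
  have h1 := spanFinrank_maximalIdeal_quotient_span_singleton hx hx2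
  have h2 : ((maximalIdeal R).spanFinrank : WithBot ℕ∞) = (n + 1 : ℕ) :=
    (IsRegularLocalRing.spanFinrank_maximalIdeal (R := R)).trans hn
  have h2' : (maximalIdeal R).spanFinrank = n + 1 := by exact_mod_cast h2
  have h3 : ((maximalIdeal (R ⧸ Ideal.span {x})).spanFinrank : WithBot ℕ∞) ≤ n := by
    exact_mod_cast (by omega : (maximalIdeal (R ⧸ Ideal.span {x})).spanFinrank ≤ n)
  have h4 : (n : WithBot ℕ∞) ≤ ringKrullDim (R ⧸ Ideal.span {x}) := by
    have h5 := ringKrullDim_le_ringKrullDim_quotient_add_card (R := R) {x} (by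
      simpa [IsLocalRing.ringJacobson_eq_maximalIdeal] using hx)
    rw [hn] at h5
    rw [Finset.card_singleton, Nat.cast_add, Nat.cast_one, Finset.coe_singleton] at h5
    exact (ENat.WithBot.add_le_add_one_right_iff).mp h5
  have h6 := ringKrullDim_le_spanFinrank_maximalIdeal (R ⧸ Ideal.span {x})
  exact ⟨IsRegularLocalRing.of_spanFinrank_maximalIdeal_le _ (h3.trans h4),
    le_antisymm (h6.trans h3) h4⟩

/-- Inductively `(x)` is prime, so it contains a minimal prime `Q`. As `x ∉ Q`, each `r x ∈ Q` has
`r ∈ Q`; thus `Q = mQ` and `Q = 0` by Nakayama. -/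
theorem isDomain_of_isRegularLocalRing (n : ℕ) (R : Type u) [CommRing R] [IsRegularLocalRing R]
    (hn : ringKrullDim R = n) : IsDomain R := by
  induction n generalizing R with
  | zero =>
    have h2 : ((maximalIdeal R).spanFinrank : WithBot ℕ∞) = (0 : ℕ) :=
      (IsRegularLocalRing.spanFinrank_maximalIdeal (R := R)).trans hn
    have h3 : (maximalIdeal R).spanFinrank = 0 := by exact_mod_cast h2
    have hbot : maximalIdeal R = ⊥ :=
      (Submodule.spanFinrank_eq_zero_iff_eq_bot (maximalIdeal R).fg_of_isNoetherianRing).mp h3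
    exact (isField_iff_maximalIdeal_eq.mpr hbot).isDomain
  | succ n ih =>
    obtain ⟨x, hx, hx2, hxmin⟩ := exists_mem_maximalIdeal_notMem_sq_notMem_minimalPrimes hn
    obtain ⟨h1, h2⟩ := isRegularLocalRing_quotient_span_singleton hn hx hx2
    have h3 := ih (R ⧸ Ideal.span {x}) h2
    have hprime : (Ideal.span {x}).IsPrime := (Ideal.Quotient.isDomain_iff_prime _).mp h3
    obtain ⟨Q, hQ, hQx⟩ := Ideal.exists_minimalPrimes_le (bot_le : ⊥ ≤ Ideal.span {x})
    have hQp : Q.IsPrime := Ideal.IsMinimalPrime.isPrime hQ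
    have hbot : Q = ⊥ := by
      refine Submodule.eq_bot_of_le_smul_of_le_jacobson_bot (maximalIdeal R) _
        Q.fg_of_isNoetherianRing ?_ (maximalIdeal_le_jacobson _)
      intro q hq
      obtain ⟨r, rfl⟩ := Ideal.mem_span_singleton'.mp (hQx hq)
      have hr : r ∈ Q := (hQp.mem_or_mem hq).resolve_right (hxmin Q hQ)
      rw [mul_comm]
      exact Submodule.smul_mem_smul hx hr
    subst hbot
    exact IsDomain.of_bot_isPrime R

theorem ringKrullDim_eq_natCast (R : Type u) [CommRing R] [IsLocalRing R] [IsNoetherianRing R] :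
    ∃ n : ℕ, ringKrullDim R = n := by
  obtain ⟨n, hn⟩ := ENat.ne_top_iff_exists.mp (Ideal.height_ne_top (I := maximalIdeal R) 
    (maximalIdeal.isMaximal R).ne_top)
  exact ⟨n, by rw [← maximalIdeal_height_eq_ringKrullDim, ← hn]; rfl⟩

instance (priority := low) IsRegularLocalRing.isDomain (R : Type u) [CommRing R]
    [IsRegularLocalRing R] : IsDomain R :=
  let ⟨n, hn⟩ := ringKrullDim_eq_natCast R
  isDomain_of_isRegularLocalRing n R hn

theorem exists_isSMulRegular_isRegularLocalRing_quotient {R : Type u} [CommRing R]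
    [IsRegularLocalRing R] {n : ℕ} (hn : ringKrullDim R = (n + 1 : ℕ)) :
    ∃ x ∈ maximalIdeal R, IsSMulRegular R x ∧ IsRegularLocalRing (R ⧸ Ideal.span {x}) ∧
      ringKrullDim (R ⧸ Ideal.span {x}) = n := by
  obtain ⟨x, hx, hx2, -⟩ := exists_mem_maximalIdeal_notMem_sq_notMem_minimalPrimes hn
  refine ⟨x, hx, ?_, isRegularLocalRing_quotient_span_singleton hn hx hx2⟩
  have : x ≠ 0 := by rintro rfl; exact hx2 (zero_mem _)
  exact fun a b h => mul_left_cancel₀ this h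

theorem hasProjectiveDimensionLE_of_isRegularLocalRing (n : ℕ) {R : Type u} [CommRing R]
    [IsRegularLocalRing R] (hn : ringKrullDim R = n) (M : Type u) [AddCommGroup M] [Module R M]
    [Module.Finite R M] : HasProjectiveDimensionLE (ModuleCat.of R M) n := by
  induction n generalizing R M with
  | zero =>
    have h2 : ((maximalIdeal R).spanFinrank : WithBot ℕ∞) = (0 : ℕ) :=
      (IsRegularLocalRing.spanFinrank_maximalIdeal (R := R)).trans hn
    have h3 : (maximalIdeal R).spanFinrank = 0 := by exact_mod_cast h2
    have hbot : maximalIdeal R = ⊥ :=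
      (Submodule.spanFinrank_eq_zero_iff_eq_bot (maximalIdeal R).fg_of_isNoetherianRing).mp h3
    rw [module_projective_iff_hasProjectiveDimensionLE_zero]
    obtain ⟨k, f, hf, hker⟩ := exists_minimal_free_cover R M
    rw [hbot, Submodule.bot_smul, le_bot_iff, LinearMap.ker_eq_bot] at hker
    exact Module.Projective.of_equiv (LinearEquiv.ofBijective f ⟨hker, hf⟩)
  | succ n ih =>
    obtain ⟨x, hxm, hx, h1, h2⟩ := exists_isSMulRegular_isRegularLocalRing_quotient hn
    obtain ⟨F, _, _, _, _, f, hf⟩ := Module.exists_finite_presentation R M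
    have hK : IsSMulRegular (LinearMap.ker f) x := (isSMulRegular_of_free hx F).submodule _
    have : Module.Finite (R ⧸ Ideal.span {x}) (QuotSMulTop x (LinearMap.ker f)) :=
      Module.Finite.of_restrictScalars_finite R _ _
    rw [hasProjectiveDimensionLE_of_syzygy (LinearMap.exact_subtype_ker_map f)
      (Submodule.subtype_injective _) hf,
      ← hasProjectiveDimensionLE_quotSMulTop_iff hxm hx n _ hK]
    exact ih h2 _

theorem projectiveDimension_ne_top_of_isRegularLocalRing {R : Type u} [CommRing R]
    [IsRegularLocalRing R] (M : Type u) [AddCommGroup M] [Module R M] [Module.Finite R M] :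
    projectiveDimension (ModuleCat.of R M) ≠ ⊤ := by
  obtain ⟨n, hn⟩ := ringKrullDim_eq_natCast R
  exact (projectiveDimension_ne_top_iff _).mpr
    ⟨n, hasProjectiveDimensionLE_of_isRegularLocalRing n hn M⟩

open RingTheory.Sequence in
theorem exists_isWeaklyRegular_length_eq_ringKrullDim (n : ℕ) (R : Type u) [CommRing R]
    [IsRegularLocalRing R] (hn : ringKrullDim R = n) :
    ∃ rs : List R, rs.length = n ∧ (∀ r ∈ rs, r ∈ maximalIdeal R) ∧ IsWeaklyRegular R rs := by
  induction n generalizing R with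
  | zero => exact ⟨[], rfl, by simp, .nil R R⟩
  | succ n ih =>
    obtain ⟨x, hxm, hx, h1, h2⟩ := exists_isSMulRegular_isRegularLocalRing_quotient hn
    obtain ⟨rs, hlen, hmem, hreg⟩ := ih (R ⧸ Ideal.span {x}) h2
    obtain ⟨rs', rfl⟩ := List.map_surjective_iff.mpr
      (Ideal.Quotient.mk_surjective (I := Ideal.span {x})) rs
    refine ⟨x :: rs', by simpa using hlen, ?_, ?_⟩
    · simp only [List.mem_cons, forall_eq_or_imp]
      refine ⟨hxm, fun r hr => ?_⟩
      by_contra hrm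
      exact (mem_maximalIdeal _).mp (hmem _ (List.mem_map_of_mem hr))
        ((notMem_maximalIdeal.mp hrm).map _)
    · rw [isWeaklyRegular_cons_iff']
      refine ⟨hx, ?_⟩
      have e : QuotSMulTop x R ≃ₗ[R] R ⧸ Ideal.span {x} :=
        Submodule.quotEquivOfEq _ _ (by simp [← Submodule.ideal_span_singleton_smul])
      exact ((e.extendScalarsOfSurjective
        Ideal.Quotient.mk_surjective).isWeaklyRegular_congr _).mpr hreg

end

/-! ### Vanishing of `Ext^i(R/I, R)` below the height of `I`. -/

section

open CategoryTheory IsLocalRing Abelian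

theorem smul_ext_eq_zero_of_mem_annihilator {R : Type u} [CommRing R] {M N : ModuleCat.{u} R}
    {x : R} (hx : x ∈ Module.annihilator R M) {i : ℕ} (e : Ext M N i) : x • e = 0 := by
  have h : x • 𝟙 M = 0 := by
    ext m
    exact Module.mem_annihilator.mp hx m
  rw [← Ext.mk₀_id_comp e, ← Ext.smul_comp, ← Ext.mk₀_smul, h, Ext.mk₀_zero, Ext.zero_comp]

theorem comp_mk₀_smul_id {R : Type u} [CommRing R] {M N : ModuleCat.{u} R} (x : R) {i : ℕ}
    (e : Ext M N i) : e.comp (Ext.mk₀ (x • 𝟙 N)) (add_zero i) = x • e := by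
  rw [Ext.mk₀_smul, Ext.comp_smul, Ext.comp_mk₀_id]

theorem mk₀_smul_id_comp {R : Type u} [CommRing R] {M N : ModuleCat.{u} R} (x : R) {i : ℕ}
    (e : Ext M N i) : (Ext.mk₀ (x • 𝟙 M)).comp e (zero_add i) = x • e := by
  rw [Ext.mk₀_smul, Ext.smul_comp, Ext.mk₀_id_comp]

-- Rees's argument: multiplication by `x` on `Ext^i(M, N)` is zero since `x` kills `M`, so every
-- class comes from `Ext^{i-1}(M, N/xN)`, which vanishes by induction.
open RingTheory.Sequence in
theorem subsingleton_ext_of_isWeaklyRegular {R : Type u} [CommRing R] (rs : List R)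
    (M N : ModuleCat.{u} R) (hrs : ∀ r ∈ rs, r ∈ Module.annihilator R M)
    (hN : IsWeaklyRegular N rs) {i : ℕ} (hi : i < rs.length) : Subsingleton (Ext M N i) := by
  induction rs generalizing N i with
  | nil => simp at hi
  | cons x rs ih =>
    simp only [List.mem_cons, forall_eq_or_imp] at hrs
    rw [isWeaklyRegular_cons_iff] at hN
    have hS := hN.1.smulShortComplex_shortExact
    refine subsingleton_of_forall_eq 0 fun e => ?_
    have he : e.comp (Ext.mk₀ (N.smulShortComplex x).f) (add_zero i) = 0 :=
      (comp_mk₀_smul_id x e).trans (smul_ext_eq_zero_of_mem_annihilator hrs.1 e)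
    cases i with
    | zero =>
      have := hS.mono_f
      exact Ext.postcomp_mk₀_injective_of_mono M (N.smulShortComplex x).f
        (he.trans (map_zero ((Ext.mk₀ (N.smulShortComplex x).f).postcomp M (add_zero 0))).symm)
    | succ i =>
      obtain ⟨e', rfl⟩ := Ext.covariant_sequence_exact₁ M hS e he rfl
      have h3 := ih (ModuleCat.of R (QuotSMulTop x N)) hrs.2 hN.2
        (by simpa using hi : i < rs.length)
      have h4 : e' = 0 := h3.elim _ _
      subst h4
      exact Ext.zero_comp (X := M) (n := i) hS.extClass (i + 1) rfl

/-- Dévissage along a prime filtration; every prime that occurs contains the annihilator of the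
module. -/
theorem subsingleton_ext_of_forall_prime {R : Type u} [CommRing R] [IsNoetherianRing R]
    (Y : ModuleCat.{u} R) (i : ℕ) (M : Type u) [AddCommGroup M] [Module R M] [Module.Finite R M]
    (h : ∀ Q : Ideal R, Q.IsPrime → Module.annihilator R M ≤ Q →
      Subsingleton (Ext (ModuleCat.of R (R ⧸ Q)) Y i)) :
    Subsingleton (Ext (ModuleCat.of R M) Y i) := by
  induction ‹Module.Finite R M› using
    IsNoetherianRing.induction_on_isQuotientEquivQuotientPrime R with
  | subsingleton N =>
    refine subsingleton_of_forall_eq 0 fun e => ?_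
    have : 𝟙 (ModuleCat.of R N) = 0 := by ext x; exact Subsingleton.elim _ _
    rw [← Ext.mk₀_id_comp e, this, Ext.mk₀_zero, Ext.zero_comp]
  | quotient N p e =>
    have h1 := h p.1 p.2 (by rw [e.annihilator_eq, Ideal.annihilator_quotient])
    refine subsingleton_of_forall_eq 0 fun x => ?_
    have : 𝟙 (ModuleCat.of R N) = e.toModuleIso.hom ≫ e.toModuleIso.inv :=
      e.toModuleIso.hom_inv_id.symm
    rw [← Ext.mk₀_id_comp x, this, ← Ext.mk₀_comp_mk₀, Ext.comp_assoc_of_second_deg_zero,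
      Subsingleton.elim ((Ext.mk₀ e.toModuleIso.inv).comp x (zero_add i)) 0, Ext.comp_zero]
  | exact N₁ N₂ N₃ f g hf hg hfg h₁ h₃ =>
    have s₁ := h₁ fun Q hQ hle => h Q hQ ((LinearMap.annihilator_le_of_injective f hf).trans hle)
    have s₃ := h₃ fun Q hQ hle => h Q hQ ((LinearMap.annihilator_le_of_surjective g hg).trans hle)
    refine subsingleton_of_forall_eq 0 fun x => ?_
    obtain ⟨y, rfl⟩ := Ext.contravariant_sequence_exact₂ (exactPair_shortExact hfg hf hg) Y x
      (Subsingleton.elim (α := Ext (ModuleCat.of R N₁) Y i) _ _)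
    rw [Subsingleton.elim (α := Ext (ModuleCat.of R N₃) Y i) y 0, Ext.comp_zero]

-- Descending induction from `m`, where a regular sequence of length `dim R` is available. For `x ∈
-- m \ P`, the module `R/(P + x)` involves only primes strictly above `P`, of height greater than `i
-- + 1`. So its `Ext^{i+1}` vanishes, `x` acts surjectively on `Ext^i(R/P, R)`, and Nakayama
-- concludes.
open Pointwise in
theorem subsingleton_ext_quotient_prime {R : Type u} [CommRing R] [IsRegularLocalRing R]
    (P : Ideal R) (hP : P.IsPrime) (i : ℕ) (hi : (i : ℕ∞) < P.height) :
    Subsingleton (Ext (ModuleCat.of R (R ⧸ P)) (ModuleCat.of R R) i) := by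
  induction P using WellFoundedGT.induction generalizing i with
  | ind P ih =>
    by_cases hPm : P = maximalIdeal R
    · subst hPm
      obtain ⟨n, hn⟩ := ringKrullDim_eq_natCast R
      obtain ⟨rs, hlen, hmem, hreg⟩ := exists_isWeaklyRegular_length_eq_ringKrullDim n R hn
      rw [← maximalIdeal_height_eq_ringKrullDim] at hn
      have hn' : (maximalIdeal R).height = n := by exact_mod_cast hn
      refine subsingleton_ext_of_isWeaklyRegular rs _ _ ?_ hreg ?_
      · intro r hr
        exact (Ideal.annihilator_quotient (I := maximalIdeal R)).symm ▸ hmem r hr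
      · rw [hn'] at hi
        rw [hlen]
        exact_mod_cast hi
    · have hlt : P < maximalIdeal R := lt_of_le_of_ne (le_maximalIdeal hP.ne_top) hPm
      obtain ⟨x, hxm, hxP⟩ := SetLike.exists_of_lt hlt
      have hreg : IsSMulRegular (R ⧸ P) x := by
        rw [isSMulRegular_quotient_iff_mem_of_smul_mem]
        intro y hy
        exact (hP.mem_or_mem hy).resolve_left hxP
      have hS := IsSMulRegular.smulShortComplex_shortExact
        (M := ModuleCat.of R (R ⧸ P)) hreg
      have h3 : Subsingleton (Ext (ModuleCat.of R (QuotSMulTop x (R ⧸ P)))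
          (ModuleCat.of R R) (i + 1)) := by
        refine subsingleton_ext_of_forall_prime _ _ _ fun Q hQ hle => ?_
        have hPQ : P < Q := by
          refine lt_of_le_of_ne ?_ ?_
          · refine le_trans ?_ hle
            refine (Ideal.annihilator_quotient (I := P)).ge.trans ?_
            exact LinearMap.annihilator_le_of_surjective
              (Submodule.mkQ (x • (⊤ : Submodule R (R ⧸ P)))) (Submodule.mkQ_surjective _)
          · rintro rfl
            exact hxP (hle (QuotSMulTop.mem_annihilator _ x))
        refine ih Q hPQ hQ (i + 1) ?_
        have h1 := Ideal.height_add_one_le_of_lt_of_isPrime hPQ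
        refine lt_of_lt_of_le ?_ h1
        push_cast
        exact (ENat.add_lt_add_iff_right (by simp)).mpr hi
      by_contra hns
      have hnt := not_subsingleton_iff_nontrivial.mp hns
      have : Module.Finite R (Ext (ModuleCat.of R (R ⧸ P)) (ModuleCat.of R R) i) :=
        ModuleCat.finite_ext R _ _ i
      have : x ∈ (Module.annihilator R (Ext (ModuleCat.of R (R ⧸ P))
          (ModuleCat.of R R) i)).jacobson := maximalIdeal_le_jacobson _ hxm
      refine Submodule.top_ne_pointwise_smul_of_mem_jacobson_annihilator this ?_
      rw [eq_comm, eq_top_iff]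
      intro e _
      obtain ⟨e', he'⟩ := Ext.contravariant_sequence_exact₁ hS (ModuleCat.of R R) e
        (add_comm 1 i) (Subsingleton.elim (α := Ext (ModuleCat.of R (QuotSMulTop x (R ⧸ P)))
          (ModuleCat.of R R) (i + 1)) _ _)
      have h4 : x • e' = e := (mk₀_smul_id_comp x e').symm.trans he'
      rw [← h4]
      exact Submodule.smul_mem_pointwise_smul _ _ ⊤ trivial

theorem subsingleton_ext_quotient_of_lt_height {R : Type u} [CommRing R] [IsRegularLocalRing R]
    (I : Ideal R) {i : ℕ} (hi : (i : ℕ∞) < I.height) :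
    Subsingleton (Ext (ModuleCat.of R (R ⧸ I)) (ModuleCat.of R R) i) := by
  refine subsingleton_ext_of_forall_prime _ _ _ fun Q hQ hle => ?_
  rw [Ideal.annihilator_quotient] at hle
  exact subsingleton_ext_quotient_prime Q hQ i (hi.trans_le (Ideal.height_mono hle))

end

/-! ### Syzygies in arbitrary free resolutions, and Schanuel's lemma. -/

section

open CategoryTheory IsLocalRing

/-- `X` is an `n`-th syzygy of `M` in some, not necessarily minimal, resolution by free modules
of finite rank. -/
def IsNthSyzygy {R : Type u} [CommRing R] (M : ModuleCat.{u} R) : ℕ → ModuleCat.{u} R → Prop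
  | 0, X => Nonempty (X ≃ₗ[R] M)
  | n + 1, X => ∃ (X' F : ModuleCat.{u} R) (i : X →ₗ[R] F) (p : F →ₗ[R] X'),
      IsNthSyzygy M n X' ∧ Module.Free R F ∧ Module.Finite R F ∧
      Function.Injective i ∧ Function.Exact i p ∧ Function.Surjective p

section Schanuel

variable {R : Type u} [CommRing R] {K₁ F₁ K₂ F₂ X : Type u}
  [AddCommGroup K₁] [Module R K₁] [AddCommGroup F₁] [Module R F₁] [AddCommGroup K₂] [Module R K₂]
  [AddCommGroup F₂] [Module R F₂] [AddCommGroup X] [Module R X]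

/-- If `F₂` is projective then the fibre product of two surjections `F₁ → X ← F₂` is
`ker (F₁ → X) × F₂`. -/
theorem nonempty_prod_equiv_ker {i₁ : K₁ →ₗ[R] F₁} {p₁ : F₁ →ₗ[R] X} (h₁ : Function.Exact i₁ p₁)
    (hi₁ : Function.Injective i₁) (hp₁ : Function.Surjective p₁) [Module.Projective R F₂]
    (p₂ : F₂ →ₗ[R] X) :
    Nonempty ((K₁ × F₂) ≃ₗ[R] LinearMap.ker (p₁ ∘ₗ LinearMap.fst R F₁ F₂ -
      p₂ ∘ₗ LinearMap.snd R F₁ F₂)) := by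
  obtain ⟨t, ht⟩ := Module.projective_lifting_property p₁ p₂ hp₁
  have ht' (b : F₂) : p₁ (t b) = p₂ b := LinearMap.congr_fun ht b
  let φ : (K₁ × F₂) →ₗ[R] F₁ × F₂ :=
    (LinearMap.coprod i₁ t).prod (LinearMap.snd R K₁ F₂)
  have hφ : ∀ x, φ x ∈ LinearMap.ker (p₁ ∘ₗ LinearMap.fst R F₁ F₂ -
      p₂ ∘ₗ LinearMap.snd R F₁ F₂) := by
    rintro ⟨k, b⟩
    simp [φ, ht', h₁.apply_apply_eq_zero]
  refine ⟨LinearEquiv.ofBijective (φ.codRestrict _ hφ) ⟨?_, ?_⟩⟩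
  · rw [← LinearMap.ker_eq_bot, LinearMap.ker_codRestrict, LinearMap.ker_eq_bot']
    rintro ⟨k, b⟩ hkb
    have hb : b = 0 := congrArg Prod.snd hkb
    subst hb
    have hk : i₁ k = 0 := by simpa [φ] using congrArg Prod.fst hkb
    rw [(map_eq_zero_iff i₁ hi₁).mp hk]
    rfl
  · rintro ⟨⟨a, b⟩, hab⟩
    have hab' : p₁ a - p₂ b = 0 := hab
    obtain ⟨k, hk⟩ := (h₁ (a - t b)).mp (by rw [map_sub, ht', hab'])
    exact ⟨(k, b), Subtype.ext (by simp [φ, hk])⟩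

/-- Both sides are the fibre product `F₁ ×_X F₂`, computed from either projection. -/
theorem schanuel [Module.Projective R F₁] [Module.Projective R F₂] {i₁ : K₁ →ₗ[R] F₁}
    {p₁ : F₁ →ₗ[R] X} (h₁ : Function.Exact i₁ p₁) (hi₁ : Function.Injective i₁)
    (hp₁ : Function.Surjective p₁) {i₂ : K₂ →ₗ[R] F₂} {p₂ : F₂ →ₗ[R] X}
    (h₂ : Function.Exact i₂ p₂) (hi₂ : Function.Injective i₂) (hp₂ : Function.Surjective p₂) :
    Nonempty ((K₁ × F₂) ≃ₗ[R] (K₂ × F₁)) := by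
  obtain ⟨e₁⟩ := nonempty_prod_equiv_ker h₁ hi₁ hp₁ p₂
  obtain ⟨e₂⟩ := nonempty_prod_equiv_ker h₂ hi₂ hp₂ p₁
  have e₃ : LinearMap.ker (p₁ ∘ₗ LinearMap.fst R F₁ F₂ - p₂ ∘ₗ LinearMap.snd R F₁ F₂) ≃ₗ[R]
      LinearMap.ker (p₂ ∘ₗ LinearMap.fst R F₂ F₁ - p₁ ∘ₗ LinearMap.snd R F₂ F₁) :=
    LinearEquiv.ofSubmodules (LinearEquiv.prodComm R F₁ F₂) _ _ (by
      ext ⟨b, a⟩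
      simp only [Submodule.mem_map, LinearMap.mem_ker, Prod.exists]
      simp [sub_eq_zero]
      exact eq_comm)
  exact ⟨e₁.trans (e₃.trans e₂.symm)⟩

end Schanuel

section

variable {R : Type u} [CommRing R]

theorem exact_prodMap_id {X F X' : Type u} (A : Type u) [AddCommGroup X] [Module R X]
    [AddCommGroup F] [Module R F] [AddCommGroup X'] [Module R X'] [AddCommGroup A] [Module R A]
    {i : X →ₗ[R] F} {p : F →ₗ[R] X'} (h : Function.Exact i p) :
    Function.Exact (LinearMap.inl R F A ∘ₗ i) (p.prodMap (LinearMap.id : A →ₗ[R] A)) := by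
  rintro ⟨f, a⟩
  constructor
  · intro hfa
    have hf : p f = 0 := congrArg Prod.fst hfa
    have ha : a = 0 := congrArg Prod.snd hfa
    obtain ⟨x, rfl⟩ := (h f).mp hf
    exact ⟨x, by simp [ha]⟩
  · rintro ⟨x, hx⟩
    simp only [LinearMap.comp_apply, LinearMap.inl_apply, Prod.mk.injEq] at hx
    obtain ⟨rfl, rfl⟩ := hx
    simp [h.apply_apply_eq_zero]

/-- Adding free modules to both resolutions makes their right-hand ends isomorphic, after which
Schanuel's lemma applies one step further left. -/
theorem IsNthSyzygy.stablyEquiv {M : ModuleCat.{u} R} {n : ℕ} {X S : ModuleCat.{u} R}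
    (hX : IsNthSyzygy M n X) (hS : IsNthSyzygy M n S) :
    ∃ A B : ModuleCat.{u} R, Module.Free R A ∧ Module.Finite R A ∧ Module.Free R B ∧
      Module.Finite R B ∧ Nonempty ((X × A) ≃ₗ[R] (S × B)) := by
  induction n generalizing X S with
  | zero =>
    obtain ⟨e⟩ := hX
    obtain ⟨e'⟩ := hS
    exact ⟨ModuleCat.of R PUnit, ModuleCat.of R PUnit,
      inferInstanceAs (Module.Free R PUnit.{u + 1}), inferInstanceAs (Module.Finite R PUnit.{u + 1}),
      inferInstanceAs (Module.Free R PUnit.{u + 1}), inferInstanceAs (Module.Finite R PUnit.{u + 1}),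
      ⟨(e.trans e'.symm).prodCongr (LinearEquiv.refl R _)⟩⟩
  | succ n ih =>
    obtain ⟨X', F, i, p, hX', _, _, hi, hip, hp⟩ := hX
    obtain ⟨S', L, j, q, hS', _, _, hj, hjq, hq⟩ := hS
    obtain ⟨A, B, _, _, _, _, ⟨e⟩⟩ := ih hX' hS'
    have h1 := exact_prodMap_id A hip
    have h2 := exact_prodMap_id B hjq
    have h2' : Function.Exact (LinearMap.inl R L B ∘ₗ j)
        (e.symm.toLinearMap ∘ₗ (q.prodMap (LinearMap.id : B →ₗ[R] B))) := by
      intro y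
      rw [← h2 y, LinearMap.comp_apply, LinearEquiv.coe_coe, LinearEquiv.map_eq_zero_iff]
    obtain ⟨E⟩ := schanuel h1 (LinearMap.inl_injective.comp hi)
      (hp.prodMap Function.surjective_id) h2' (LinearMap.inl_injective.comp hj)
      (e.symm.surjective.comp (hq.prodMap Function.surjective_id))
    exact ⟨ModuleCat.of R (L × B), ModuleCat.of R (F × A),
      inferInstanceAs (Module.Free R (L × B)), inferInstanceAs (Module.Finite R (L × B)),
      inferInstanceAs (Module.Free R (F × A)), inferInstanceAs (Module.Finite R (F × A)), ⟨E⟩⟩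

end

section MinimalFreeResolution

theorem exact_subtype_range {R M N P : Type*} [CommRing R] [AddCommGroup M] [Module R M]
    [AddCommGroup N] [Module R N] [AddCommGroup P] [Module R P] {f : M →ₗ[R] N} {g : N →ₗ[R] P}
    (h : Function.Exact f g) : Function.Exact (LinearMap.range f).subtype g :=
  LinearMap.exact_iff.mpr (by rw [Submodule.range_subtype]; exact h.linearMap_ker_eq)

theorem exact_rangeRestrict {R M N P : Type*} [CommRing R] [AddCommGroup M] [Module R M]
    [AddCommGroup N] [Module R N] [AddCommGroup P] [Module R P] {f : M →ₗ[R] N} {g : N →ₗ[R] P}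
    (h : Function.Exact f g) : Function.Exact f g.rangeRestrict :=
  LinearMap.exact_iff.mpr (by rw [LinearMap.ker_rangeRestrict]; exact h.linearMap_ker_eq)

variable {R : Type u} [CommRing R] [IsLocalRing R] {M : Type u} [AddCommGroup M] [Module R M]
  (L : MinimalFreeResolution R M)

theorem MinimalFreeResolution.exists_syz_exact (n : ℕ) :
    ∃ (i : L.syz (n + 1) →ₗ[R] (Fin (L.rank n) → R)) (p : (Fin (L.rank n) → R) →ₗ[R] L.syz n),
      Function.Injective i ∧ Function.Exact i p ∧ Function.Surjective p := by
  cases n with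
  | zero =>
    refine ⟨(LinearMap.range (L.d 0)).subtype, L.aug, Submodule.subtype_injective _,
      exact_subtype_range L.exact_aug, L.aug_surjective⟩
  | succ n =>
    refine ⟨(LinearMap.range (L.d (n + 1))).subtype, (L.d n).rangeRestrict,
      Submodule.subtype_injective _, exact_rangeRestrict (exact_subtype_range (L.exact_d n)),
      LinearMap.surjective_rangeRestrict _⟩

theorem MinimalFreeResolution.isNthSyzygy_syz (n : ℕ) :
    IsNthSyzygy (ModuleCat.of R M) n (L.syz n) := by
  induction n with
  | zero => exact ⟨LinearEquiv.refl R _⟩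
  | succ n ih =>
    obtain ⟨i, p, hi, hip, hp⟩ := L.exists_syz_exact n
    exact ⟨L.syz n, ModuleCat.of R (Fin (L.rank n) → R), i, p, ih,
      inferInstanceAs (Module.Free R (Fin (L.rank n) → R)),
      inferInstanceAs (Module.Finite R (Fin (L.rank n) → R)), hi, hip, hp⟩

end MinimalFreeResolution

/-! ### Grade and order ideals. -/

section Grade

variable {R : Type u} [CommRing R]

theorem idealGrade_mono {a b : Ideal R} (h : a ≤ b) : idealGrade a ≤ idealGrade b :=
  iSup_le fun rs => le_iSup_of_le ⟨rs.1, rs.2.1, fun r hr => h (rs.2.2 r hr)⟩ le_rfl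

open RingTheory.Sequence in
theorem isWeaklyRegular_replicate_one (n : ℕ) (M : Type v) [AddCommGroup M] [Module R M] :
    IsWeaklyRegular M (List.replicate n (1 : R)) := by
  induction n generalizing M with
  | zero => exact .nil R M
  | succ n ih =>
    rw [List.replicate_succ, isWeaklyRegular_cons_iff]
    exact ⟨IsSMulRegular.one M, ih _⟩

theorem idealGrade_top : idealGrade (⊤ : Ideal R) = ⊤ := by
  refine ENat.eq_top_iff_forall_ge.mpr fun n => ?_
  refine le_iSup_of_le ⟨List.replicate n 1, isWeaklyRegular_replicate_one n R, by simp⟩ ?_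
  simp

/-- After localizing at `P`, a weakly regular sequence in `a` becomes regular and lowers the
dimension of `R_P`, which is the height of `P`, by its length. -/
theorem idealGrade_le_height [IsNoetherianRing R] {a P : Ideal R} [P.IsPrime] (h : a ≤ P) :
    idealGrade a ≤ P.height := by
  refine iSup_le fun rs => ?_
  have hreg := rs.2.1.isRegular_of_isLocalization_of_mem (Localization.AtPrime P) P
    fun r hr => h (rs.2.2 r hr)
  have hdim := ringKrullDim_add_length_eq_ringKrullDim_of_isRegular _ hreg
  rw [IsLocalization.AtPrime.ringKrullDim_eq_height P (Localization.AtPrime P),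
    List.length_map] at hdim
  have hnt : Nontrivial (Localization.AtPrime P ⧸
      Ideal.ofList (rs.1.map (algebraMap R (Localization.AtPrime P)))) := by
    refine Ideal.Quotient.nontrivial_iff.mpr fun htop => hreg.2 ?_
    rw [htop]; simp
  have h0 := ringKrullDim_nonneg_of_nontrivial (R := Localization.AtPrime P ⧸
      Ideal.ofList (rs.1.map (algebraMap R (Localization.AtPrime P))))
  have h1 : (rs.1.length : WithBot ℕ∞) ≤ P.height := by
    rw [← hdim]
    exact le_add_of_nonneg_left h0
  exact_mod_cast h1

theorem orderIdeal_le_of_map {X Y : Type u} [AddCommGroup X] [Module R X] [AddCommGroup Y]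
    [Module R Y] (f : X →ₗ[R] Y) (x : X) : orderIdeal R (f x) ≤ orderIdeal R x := by
  rintro _ ⟨g, rfl⟩
  exact ⟨g ∘ₗ f, rfl⟩

theorem smul_top_le_comap {X Y : Type u} [AddCommGroup X] [Module R X] [AddCommGroup Y]
    [Module R Y] (f : X →ₗ[R] Y) (a : Ideal R) :
    a • (⊤ : Submodule R X) ≤ (a • (⊤ : Submodule R Y)).comap f := by
  rw [← Submodule.map_le_iff_le_comap, Submodule.map_smul'']
  exact smul_mono_right _ le_top

theorem orderIdeal_eq_top_of_free [IsLocalRing R] {B : Type u} [AddCommGroup B] [Module R B]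
    [Module.Free R B] [Module.Finite R B] {b : B} (hb : IsMinimalGenerator R b) :
    orderIdeal R b = ⊤ := by
  by_contra hne
  have hle := le_maximalIdeal hne
  let β := Module.Free.chooseBasis R B
  refine hb ?_
  rw [← β.sum_repr b]
  exact Submodule.sum_mem _ fun l _ =>
    Submodule.smul_mem_smul (hle ⟨β.coord l, rfl⟩) trivial

/-- The order ideal conjecture implies the same estimate for the syzygies in resolutions that are
not necessarily minimal. -/
theorem OrderIdealConjecture.le_idealGrade_of_isNthSyzygy [IsRegularLocalRing R]
    (hR : OrderIdealConjecture R) {M : Type u} [AddCommGroup M] [Module R M] [Module.Finite R M]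
    {n : ℕ} (hn : 0 < n) {X : ModuleCat.{u} R} (hX : IsNthSyzygy (ModuleCat.of R M) n X) {e : X}
    (he : IsMinimalGenerator R e) : (n : ℕ∞) ≤ idealGrade (orderIdeal R e) := by
  obtain ⟨L⟩ := MinimalFreeResolution.nonempty R M
  obtain ⟨A, B, _, _, _, _, ⟨E⟩⟩ := hX.stablyEquiv (L.isNthSyzygy_syz n)
  let f : X →ₗ[R] L.syz n := LinearMap.fst R _ _ ∘ₗ E.toLinearMap ∘ₗ LinearMap.inl R _ _
  let g : X →ₗ[R] B := LinearMap.snd R _ _ ∘ₗ E.toLinearMap ∘ₗ LinearMap.inl R _ _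
  by_cases hf : IsMinimalGenerator R (f e)
  · exact (hR M (projectiveDimension_ne_top_of_isRegularLocalRing M) L n hn (f e) hf).trans
      (idealGrade_mono (orderIdeal_le_of_map f e))
  by_cases hg : IsMinimalGenerator R (g e)
  · have h1 := orderIdeal_le_of_map g e
    rw [orderIdeal_eq_top_of_free hg, top_le_iff] at h1
    rw [h1, idealGrade_top]
    exact le_top
  -- Neither component of `e` in `Syz^n(M) × B` is a minimal generator; transporting both back and
  -- projecting to the summand `X` puts `e` in `m X`.
  exfalso
  refine he ?_
  simp only [IsMinimalGenerator, not_not] at hf hg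
  have h1 := smul_top_le_comap (LinearMap.fst R X A ∘ₗ E.symm.toLinearMap ∘ₗ
    LinearMap.inl R (L.syz n) B) (maximalIdeal R) hf
  have h2 := smul_top_le_comap (LinearMap.fst R X A ∘ₗ E.symm.toLinearMap ∘ₗ
    LinearMap.inr R (L.syz n) B) (maximalIdeal R) hg
  rw [Submodule.mem_comap] at h1 h2
  have h3 : E.symm ((E (e, 0)).1, 0) + E.symm (0, (E (e, 0)).2) = (e, 0) := by
    rw [← map_add, Prod.mk_add_mk, add_zero, zero_add, Prod.mk.eta, E.symm_apply_apply]
  have h4 : (E.symm ((E (e, 0)).1, 0)).1 + (E.symm (0, (E (e, 0)).2)).1 = e := congrArg Prod.fst h3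
  rw [← h4]
  exact add_mem h1 h2

end Grade

end

/-! ### Splitting of syzygies after localization. -/

section

open CategoryTheory IsLocalRing

section Localization

variable {R : Type u} [CommRing R]

theorem IsNthSyzygy.hasProjectiveDimensionLE_localizedModule {M : ModuleCat.{u} R}
    (S : Submonoid R) {n k : ℕ} (h : HasProjectiveDimensionLE (M.localizedModule S) (n + k))
    {X : ModuleCat.{u} R} (hX : IsNthSyzygy M n X) :
    HasProjectiveDimensionLE (X.localizedModule S) k := by
  induction n generalizing X k with
  | zero =>
    obtain ⟨e⟩ := hX
    rw [zero_add] at h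
    exact @hasProjectiveDimensionLT_of_iso _ _ _ _ _
      ((ModuleCat.localizedModuleFunctor.{u} S).mapIso e.symm.toModuleIso) (k + 1) h
  | succ n ih =>
    obtain ⟨X', F, i, p, hX', _, _, hi, hip, hp⟩ := hX
    have h' := ih (k := k + 1) (by rwa [show n + (k + 1) = n + 1 + k by omega]) hX'
    have hT := (exactPair_shortExact hip hi hp).map_of_exact (ModuleCat.localizedModuleFunctor S)
    have hF : Projective (exactPair hip).X₂ :=
      IsProjective.iff_projective _ |>.mp (inferInstanceAs (Module.Projective R F))
    have hp2 : Projective ((exactPair hip).map (ModuleCat.localizedModuleFunctor S)).X₂ :=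
      (ModuleCat.localizedModuleFunctor.{u} S).projective_obj _
    exact (hT.hasProjectiveDimensionLT_X₃_iff k hp2).mp h'

/-- Finite projective dimension survives localization, and the Krull dimension bound over `R_P`
sharpens it to the height. Regularity of `R_P` is not needed. -/
theorem hasProjectiveDimensionLE_localizedModule_of_height [IsRegularLocalRing R] (M : Type u)
    [AddCommGroup M] [Module R M] [Module.Finite R M] (P : Ideal R) [P.IsPrime] {d : ℕ}
    (hd : P.height = d) :
    HasProjectiveDimensionLE ((ModuleCat.of R M).localizedModule P.primeCompl) d := by
  obtain ⟨n, hn⟩ := ringKrullDim_eq_natCast R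
  have h1 := hasProjectiveDimensionLE_of_isRegularLocalRing n hn M
  have h2 := ModuleCat.localizedModule_hasProjectiveDimensionLE n P.primeCompl (ModuleCat.of R M)
  have : IsLocalRing (Localization P.primeCompl) :=
    inferInstanceAs (IsLocalRing (Localization.AtPrime P))
  have : IsNoetherianRing (Localization P.primeCompl) :=
    inferInstanceAs (IsNoetherianRing (Localization.AtPrime P))
  have := ModuleCat.localizedModule_isLocalizedModule (ModuleCat.of R M) P.primeCompl
  have : Module.Finite R (ModuleCat.of R M) := inferInstanceAs (Module.Finite R M)
  have : Module.Finite (Localization P.primeCompl)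
      ((ModuleCat.of R M).localizedModule P.primeCompl) :=
    Module.Finite.of_isLocalizedModule P.primeCompl
      ((ModuleCat.of R M).localizedModuleMkLinearMap P.primeCompl)
  have h3 : ringKrullDim (Localization P.primeCompl) = d := by
    rw [IsLocalization.AtPrime.ringKrullDim_eq_height P (Localization P.primeCompl), hd]
    rfl
  exact hasProjectiveDimensionLE_ringKrullDim d h3
    ((ModuleCat.of R M).localizedModule P.primeCompl) n h2

/-- The localized surjection splits; finite presentation of `X` descends the section to `R` at the
cost of a denominator `s`. -/
theorem exists_section_of_projective_localizedModule [IsNoetherianRing R] (S : Submonoid R)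
    {C X : ModuleCat.{u} R} [Module.Finite R C] {q : C →ₗ[R] X} (hq : Function.Surjective q)
    (hX : HasProjectiveDimensionLE (X.localizedModule S) 0) :
    ∃ (s : S) (h : X →ₗ[R] C), q ∘ₗ h = (s : R) • LinearMap.id := by
  have : Module.Finite R X := Module.Finite.of_surjective q hq
  have : Module.FinitePresentation R X := Module.finitePresentation_of_finite R X
  let fC := C.localizedModuleMkLinearMap S
  let fX := X.localizedModuleMkLinearMap S
  have hproj : Module.Projective (Localization S) (X.localizedModule S) :=
    (module_projective_iff_hasProjectiveDimensionLE_zero _).mp hX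
  let qS := IsLocalizedModule.mapExtendScalars S fC fX (Localization S) q
  have hqS : Function.Surjective qS := IsLocalizedModule.map_surjective S fC fX q hq
  obtain ⟨σ, hσ⟩ := Module.projective_lifting_property qS LinearMap.id hqS
  obtain ⟨h, s, hs⟩ := Module.FinitePresentation.exists_lift_of_isLocalizedModule S fC
    (σ.restrictScalars R ∘ₗ fX)
  have hcomp : fX ∘ₗ (q ∘ₗ h) = fX ∘ₗ ((s : R) • LinearMap.id) := by
    ext x
    have h1 : fC (h x) = s • σ (fX x) := LinearMap.congr_fun hs x
    have h2 : qS (fC (h x)) = fX (q (h x)) := IsLocalizedModule.map_apply S fC fX q (h x)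
    have h3 : qS (σ (fX x)) = fX x := LinearMap.congr_fun hσ (fX x)
    have h4 : qS ((s : R) • σ (fX x)) = (s : R) • qS (σ (fX x)) :=
      (qS.restrictScalars R).map_smul (s : R) (σ (fX x))
    change fX (q (h x)) = fX ((s : R) • x)
    rw [← h2, h1, Submonoid.smul_def, h4, h3, map_smul]
  obtain ⟨s', hs'⟩ := Module.Finite.exists_smul_of_comp_eq_of_isLocalizedModule S fX _ _ hcomp
  refine ⟨s' * s, (s' : R) • h, ?_⟩
  rw [LinearMap.comp_smul]
  refine hs'.trans ?_
  rw [Submonoid.smul_def, smul_smul, Submonoid.coe_mul]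

theorem exists_retraction_of_projective_localizedModule [IsNoetherianRing R] (S : Submonoid R)
    {Y C X : ModuleCat.{u} R} [Module.Finite R C] {i : Y →ₗ[R] C} {q : C →ₗ[R] X} (hi : Function.Injective i)
    (hiq : Function.Exact i q) (hq : Function.Surjective q)
    (hX : HasProjectiveDimensionLE (X.localizedModule S) 0) :
    ∃ (s : S) (t : C →ₗ[R] Y), t ∘ₗ i = (s : R) • LinearMap.id := by
  obtain ⟨s, h, hs⟩ := exists_section_of_projective_localizedModule S hq hX
  have hs' (x : X) : q (h x) = (s : R) • x := LinearMap.congr_fun hs x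
  -- Subtracting the section part leaves a map into `ker q = im i` which is multiplication by `s` on
  -- `Y`.
  let r : C →ₗ[R] C := (s : R) • LinearMap.id - h ∘ₗ q
  have hr : ∀ c, r c ∈ LinearMap.range i := by
    intro c
    refine (hiq (r c)).mp ?_
    simp [r, hs']
  refine ⟨s, (LinearEquiv.ofInjective i hi).symm.toLinearMap ∘ₗ r.codRestrict _ hr, ?_⟩
  ext y
  refine (LinearEquiv.symm_apply_eq (LinearEquiv.ofInjective i hi)).mpr (Subtype.ext ?_)
  simp [r, hiq.apply_apply_eq_zero]

end Localization

/-- An element `e` of a `(d + 1)`-st syzygy which becomes divisible by an ideal `I` of height `d`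
in the ambient free module has an order ideal contained in a prime of height `d`. -/
theorem idealGrade_orderIdeal_le_height {R : Type u} [CommRing R] [IsRegularLocalRing R]
    {I : Ideal R} {d : ℕ} (hd : I.height = d) {M : Type u} [AddCommGroup M] [Module R M]
    [Module.Finite R M] {Y C X : ModuleCat.{u} R} [Module.Finite R C]
    (hX : IsNthSyzygy (ModuleCat.of R M) d X)
    {i : Y →ₗ[R] C} {q : C →ₗ[R] X} (hi : Function.Injective i) (hiq : Function.Exact i q)
    (hq : Function.Surjective q) {e : Y} (he : i e ∈ I • (⊤ : Submodule R C)) :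
    idealGrade (orderIdeal R e) ≤ d := by
  obtain ⟨P, hP, hIP, hPd⟩ := Ideal.exists_isPrime_height_eq hd
  have hXP : HasProjectiveDimensionLE (X.localizedModule P.primeCompl) 0 :=
    hX.hasProjectiveDimensionLE_localizedModule P.primeCompl
      (hasProjectiveDimensionLE_localizedModule_of_height M P hPd)
  obtain ⟨s, t, ht⟩ := exists_retraction_of_projective_localizedModule P.primeCompl hi hiq hq hXP
  rw [← hPd]
  refine idealGrade_le_height ?_
  rintro _ ⟨f, rfl⟩
  have h1 : t (i e) = (s : R) • e := LinearMap.congr_fun ht e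
  have h2 : f (t (i e)) ∈ I • (⊤ : Submodule R R) := smul_top_le_comap (f ∘ₗ t) I he
  rw [h1, map_smul, smul_eq_mul, smul_eq_mul, Ideal.mul_top] at h2
  -- Here `s · f e ∈ I ⊆ P` with `s ∉ P`, so every value of the order ideal lies in `P`.
  exact (hP.mem_or_mem (hIP h2)).resolve_left s.2

end

/-! ### Connecting maps and dimension shifting for `Ext(-, R)`. -/

section

open CategoryTheory IsLocalRing Abelian

section ExtOne

variable {R : Type u} [CommRing R] {S F X : Type u} [AddCommGroup S] [Module R S]
  [AddCommGroup F] [Module R F] [AddCommGroup X] [Module R X] {i : S →ₗ[R] F} {p : F →ₗ[R] X}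

/-- The connecting map `Hom(S, R) → Ext¹(X, R)` of a short exact sequence `0 → S → F → X → 0`
with `F` projective is surjective, and its kernel consists of the maps which extend to `F`. -/
theorem exists_connecting_ext_one [Module.Projective R F] (hip : Function.Exact i p)
    (hi : Function.Injective i) (hp : Function.Surjective p) :
    ∃ δ : (S →ₗ[R] R) →ₗ[R] Ext (ModuleCat.of R X) (ModuleCat.of R R) 1,
      Function.Surjective δ ∧ ∀ f, δ f = 0 ↔ ∃ g : F →ₗ[R] R, f = g ∘ₗ i := by
  have hS := exactPair_shortExact hip hi hp
  have hF : Projective (exactPair hip).X₂ :=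
    IsProjective.iff_projective _ |>.mp (inferInstanceAs (Module.Projective R F))
  let e : (S →ₗ[R] R) ≃ₗ[R] Ext (ModuleCat.of R S) (ModuleCat.of R R) 0 :=
    (Ext.linearEquiv₀.trans ModuleCat.homLinearEquiv).symm
  have he : ∀ f : S →ₗ[R] R, e f = Ext.mk₀ (ModuleCat.ofHom f) := fun f => rfl
  let δ₀ : Ext (ModuleCat.of R S) (ModuleCat.of R R) 0 →ₗ[R]
      Ext (ModuleCat.of R X) (ModuleCat.of R R) 1 :=
    hS.extClass.precompOfLinear R (ModuleCat.of R R) (add_zero 1)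
  have hδ₀ : ∀ x, δ₀ x = hS.extClass.comp x (add_zero 1) := fun x => rfl
  refine ⟨δ₀ ∘ₗ e.toLinearMap, ?_, fun f => ⟨fun h => ?_, ?_⟩⟩
  · exact (precomp_extClass_surjective_of_projective_X₂ (ModuleCat.of R R) hS 0).comp e.surjective
  · obtain ⟨x, hx⟩ := Ext.contravariant_sequence_exact₁ hS (ModuleCat.of R R) (e f) (add_zero 1) h
    obtain ⟨g, rfl⟩ := (Ext.mk₀_bijective _ _).2 x
    rw [Ext.mk₀_comp_mk₀, he] at hx
    have := (Ext.mk₀_bijective _ _).1 hx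
    exact ⟨g.hom, (congrArg ModuleCat.Hom.hom this).symm⟩
  · rintro ⟨g, rfl⟩
    change δ₀ (e (g ∘ₗ i)) = 0
    rw [hδ₀, he, ModuleCat.ofHom_comp, ← Ext.mk₀_comp_mk₀]
    exact hS.extClass_comp_assoc _

theorem exists_ext_shift [Module.Projective R F] (hip : Function.Exact i p)
    (hi : Function.Injective i) (hp : Function.Surjective p) (n : ℕ) :
    Nonempty (Ext (ModuleCat.of R S) (ModuleCat.of R R) (n + 1) ≃ₗ[R]
      Ext (ModuleCat.of R X) (ModuleCat.of R R) (n + 2)) := by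
  have hS := exactPair_shortExact hip hi hp
  have hF : Projective (exactPair hip).X₂ :=
    IsProjective.iff_projective _ |>.mp (inferInstanceAs (Module.Projective R F))
  let δ : Ext (ModuleCat.of R S) (ModuleCat.of R R) (n + 1) →ₗ[R]
      Ext (ModuleCat.of R X) (ModuleCat.of R R) (n + 2) :=
    hS.extClass.precompOfLinear R (ModuleCat.of R R) (add_comm 1 (n + 1))
  refine ⟨LinearEquiv.ofBijective δ ⟨?_, ?_⟩⟩
  · rw [← LinearMap.ker_eq_bot, LinearMap.ker_eq_bot']
    intro x hx
    obtain ⟨y, rfl⟩ := Ext.contravariant_sequence_exact₁ hS (ModuleCat.of R R) x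
      (add_comm 1 (n + 1)) hx
    rw [Ext.eq_zero_of_projective y]
    exact Ext.comp_zero _ _ _ _ _
  · exact precomp_extClass_surjective_of_projective_X₂ (ModuleCat.of R R) hS (n + 1)

end ExtOne

end

/-! ### Ext of `R/I` as cohomology of the dual complex. -/

section

open CategoryTheory IsLocalRing Abelian

section DualComplex

variable {R : Type u} [CommRing R]

theorem exists_ker_dualMap_equiv {F' F S : Type u} [AddCommGroup F'] [Module R F']
    [AddCommGroup F] [Module R F] [AddCommGroup S] [Module R S] {d : F' →ₗ[R] F} {p : F →ₗ[R] S}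
    (hdp : Function.Exact d p) (hp : Function.Surjective p) :
    ∃ κ : LinearMap.ker d.dualMap ≃ₗ[R] (S →ₗ[R] R), ∀ f, κ f ∘ₗ p = f.1 := by
  have hmem : ∀ h : S →ₗ[R] R, LinearMap.lcomp R R p h ∈ LinearMap.ker d.dualMap := by
    intro h
    ext x
    exact (congrArg h (hdp.apply_apply_eq_zero x)).trans h.map_zero
  let κ := LinearEquiv.ofBijective ((LinearMap.lcomp R R p).codRestrict _ hmem) (by
    refine ⟨fun h h' hh => ?_, fun f => ?_⟩
    · exact (LinearMap.cancel_right hp).mp (congrArg Subtype.val hh)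
    · have hf : LinearMap.ker p ≤ LinearMap.ker f.1 := by
        intro x hx
        obtain ⟨y, rfl⟩ := (hdp x).mp hx
        exact LinearMap.congr_fun f.2 y
      refine ⟨(LinearMap.ker p).liftQ f.1 hf ∘ₗ (p.quotKerEquivOfSurjective hp).symm.toLinearMap,
        Subtype.ext (LinearMap.ext fun x => ?_)⟩
      have : (p.quotKerEquivOfSurjective hp).symm (p x) = (LinearMap.ker p).mkQ x :=
        (LinearEquiv.symm_apply_eq _).mpr rfl
      change (LinearMap.ker p).liftQ f.1 hf ((p.quotKerEquivOfSurjective hp).symm (p x)) = f.1 x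
      rw [this]
      rfl)
  exact ⟨κ.symm, fun f => congrArg Subtype.val (κ.apply_symm_apply f)⟩

variable [IsLocalRing R]

theorem MinimalFreeResolution.exists_cover {M : Type u} [AddCommGroup M] [Module R M]
    (L : MinimalFreeResolution R M) (n : ℕ) :
    ∃ p : (Fin (L.rank n) → R) →ₗ[R] L.syz n,
      Function.Surjective p ∧ Function.Exact (L.d n) p := by
  cases n with
  | zero => exact ⟨L.aug, L.aug_surjective, L.exact_aug⟩
  | succ n =>
    exact ⟨(L.d n).rangeRestrict, LinearMap.surjective_rangeRestrict _,
      exact_rangeRestrict (L.exact_d n)⟩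

theorem MinimalFreeResolution.nonempty_ext_syz_equiv {M : Type u} [AddCommGroup M] [Module R M]
    (L : MinimalFreeResolution R M) (j n m : ℕ) (hm : m = n + 1 + j) :
    Nonempty (Ext (L.syz j) (ModuleCat.of R R) (n + 1) ≃ₗ[R]
      Ext (ModuleCat.of R M) (ModuleCat.of R R) m) := by
  induction j generalizing n m with
  | zero => subst hm; exact ⟨LinearEquiv.refl R _⟩
  | succ j ih =>
    obtain ⟨p, hp, hdp⟩ := L.exists_cover j
    obtain ⟨e⟩ := exists_ext_shift (exact_subtype_range hdp) (Submodule.subtype_injective _) hp n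
    obtain ⟨e'⟩ := ih (n + 1) m (by omega)
    exact ⟨e.trans e'⟩

theorem MinimalFreeResolution.exists_connecting_ext {M : Type u} [AddCommGroup M] [Module R M]
    (L : MinimalFreeResolution R M) (j : ℕ) :
    ∃ δ : (LinearMap.range (L.d j) →ₗ[R] R) →ₗ[R]
        Ext (ModuleCat.of R M) (ModuleCat.of R R) (j + 1),
      Function.Surjective δ ∧
        ∀ f, δ f = 0 ↔ ∃ g : (Fin (L.rank j) → R) →ₗ[R] R, f = g ∘ₗ Submodule.subtype _ := by
  obtain ⟨p, hp, hdp⟩ := L.exists_cover j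
  obtain ⟨δ, hδ, hδ0⟩ := exists_connecting_ext_one (exact_subtype_range hdp)
    (Submodule.subtype_injective _) hp
  obtain ⟨e⟩ := L.nonempty_ext_syz_equiv j 0 (j + 1) (by omega)
  refine ⟨e.toLinearMap ∘ₗ δ, e.surjective.comp hδ, fun f => ?_⟩
  rw [← hδ0 f]
  exact e.map_eq_zero_iff

variable {I : Ideal R} (G : MinimalFreeResolution R I)

/-- The coboundaries of the dual of the resolution `⋯ → G₁ → G₀ → R → R/I → 0` of `R/I` obtained
from a resolution `G` of `I`. -/
def MinimalFreeResolution.coboundaries :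
    ∀ j : ℕ, Submodule R (Module.Dual R (Fin (G.rank j) → R))
  | 0 => Submodule.span R {I.subtype ∘ₗ G.aug}
  | j + 1 => LinearMap.range (G.d j).dualMap

theorem MinimalFreeResolution.coboundaries_le_ker (j : ℕ) :
    G.coboundaries j ≤ LinearMap.ker (G.d j).dualMap := by
  cases j with
  | zero =>
    refine (Submodule.span_singleton_le_iff_mem _ _).mpr (LinearMap.ext fun x => ?_)
    exact congrArg Subtype.val (G.exact_aug.apply_apply_eq_zero x)
  | succ j =>
    rintro _ ⟨g, rfl⟩
    refine LinearMap.ext fun x => ?_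
    exact (congrArg g ((G.exact_d j).apply_apply_eq_zero x)).trans g.map_zero

/-- Identifies cocycles modulo coboundaries with `Ext`. The degree is `j + 1` because `G` resolves
`I`, so `G_j` sits in degree `j + 1` of the resolution of `R/I`. -/
theorem MinimalFreeResolution.exists_ker_dualMap_to_ext (j n : ℕ) (hn : n = j + 1) :
    ∃ δ : LinearMap.ker (G.d j).dualMap →ₗ[R]
        Ext (ModuleCat.of R (R ⧸ I)) (ModuleCat.of R R) n,
      Function.Surjective δ ∧ ∀ f, δ f = 0 ↔ f.1 ∈ G.coboundaries j := by
  subst hn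
  have hI : Function.Exact I.subtype (Submodule.mkQ I) := LinearMap.exact_subtype_mkQ I
  cases j with
  | zero =>
    obtain ⟨δ, hδ, hδ0⟩ := exists_connecting_ext_one hI (Submodule.subtype_injective _)
      (Submodule.mkQ_surjective I)
    obtain ⟨κ, hκ⟩ := exists_ker_dualMap_equiv G.exact_aug G.aug_surjective
    refine ⟨δ ∘ₗ κ.toLinearMap, hδ.comp κ.surjective, fun f => ?_⟩
    refine (hδ0 (κ f)).trans (Iff.trans ?_ Submodule.mem_span_singleton.symm)
    constructor
    · rintro ⟨g, hg⟩
      refine ⟨g 1, ?_⟩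
      rw [← hκ f, hg]
      refine LinearMap.ext fun x => ?_
      change g 1 • (G.aug x : R) = g (G.aug x : R)
      rw [smul_eq_mul, mul_comm, ← smul_eq_mul, ← map_smul, smul_eq_mul, mul_one]
    · rintro ⟨a, ha⟩
      refine ⟨a • LinearMap.id, (LinearMap.cancel_right G.aug_surjective).mp ?_⟩
      rw [hκ f, ← ha]
      rfl
  | succ j =>
    obtain ⟨e⟩ := exists_ext_shift hI (Submodule.subtype_injective _)
      (Submodule.mkQ_surjective I) j
    obtain ⟨δ, hδ, hδ0⟩ := G.exists_connecting_ext j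
    obtain ⟨κ, hκ⟩ := exists_ker_dualMap_equiv (exact_rangeRestrict (G.exact_d j))
      (LinearMap.surjective_rangeRestrict _)
    refine ⟨e.toLinearMap ∘ₗ δ ∘ₗ κ.toLinearMap, e.surjective.comp (hδ.comp κ.surjective),
      fun f => ?_⟩
    refine e.map_eq_zero_iff.trans ((hδ0 (κ f)).trans ?_)
    constructor
    · rintro ⟨g, hg⟩
      refine ⟨g, ?_⟩
      rw [← hκ f, hg]
      rfl
    · rintro ⟨g, hg⟩
      refine ⟨g, (LinearMap.cancel_right (LinearMap.surjective_rangeRestrict _)).mp ?_⟩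
      rw [hκ f, ← hg]
      rfl

end DualComplex

/-! ### The horseshoe lemma and the criterion for a free summand. -/

section Horseshoe

variable {R : Type u} [CommRing R]

/-- The horseshoe lemma for one step of a resolution. -/
theorem horseshoe {B Y Z B' E Z' L : Type u} [AddCommGroup B] [Module R B] [AddCommGroup Y]
    [Module R Y] [AddCommGroup Z] [Module R Z] [AddCommGroup B'] [Module R B'] [AddCommGroup E]
    [Module R E] [AddCommGroup Z'] [Module R Z'] [AddCommGroup L] [Module R L]
    [Module.Projective R L] {β : B →ₗ[R] Y} {π : Y →ₗ[R] Z} (hβ : Function.Injective β)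
    (hβπ : Function.Exact β π) (hπ : Function.Surjective π) {α : B' →ₗ[R] E} {ε : E →ₗ[R] B}
    (hα : Function.Injective α) (hαε : Function.Exact α ε) (hε : Function.Surjective ε)
    {ι : Z' →ₗ[R] L} {ρ : L →ₗ[R] Z} (hι : Function.Injective ι) (hιρ : Function.Exact ι ρ)
    (hρ : Function.Surjective ρ) :
    ∃ (Y' : ModuleCat.{u} R) (β' : B' →ₗ[R] Y') (π' : Y' →ₗ[R] Z') (i : Y' →ₗ[R] E × L)
      (q : E × L →ₗ[R] Y), Function.Injective β' ∧ Function.Exact β' π' ∧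
      Function.Surjective π' ∧ Function.Injective i ∧ Function.Exact i q ∧
      Function.Surjective q ∧ ∀ b, i (β' b) = LinearMap.inl R E L (α b) := by
  obtain ⟨l, hl⟩ := Module.projective_lifting_property π ρ hπ
  have hl' (x : L) : π (l x) = ρ x := LinearMap.congr_fun hl x
  let q : E × L →ₗ[R] Y := (β ∘ₗ ε).coprod l
  have hq' (x : E × L) : q x = β (ε x.1) + l x.2 := rfl
  have hπq (x : E × L) : π (q x) = ρ x.2 := by
    rw [hq', map_add, hβπ.apply_apply_eq_zero, zero_add, hl']
  have hq : Function.Surjective q := by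
    intro y
    obtain ⟨x, hx⟩ := hρ (π y)
    obtain ⟨b, hb⟩ := (hβπ (y - l x)).mp (by rw [map_sub, hl', hx, sub_self])
    obtain ⟨e, rfl⟩ := hε b
    exact ⟨(e, x), by rw [hq', hb, sub_add_cancel]⟩
  let β' : B' →ₗ[R] LinearMap.ker q :=
    (LinearMap.inl R E L ∘ₗ α).codRestrict _ (fun b => by
      simp [hq', hαε.apply_apply_eq_zero])
  have hmem : ∀ y : LinearMap.ker q, y.1.2 ∈ LinearMap.range ι := fun y =>
    (hιρ y.1.2).mp (by rw [← hπq, LinearMap.mem_ker.mp y.2, map_zero])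
  let π' : LinearMap.ker q →ₗ[R] Z' := (LinearEquiv.ofInjective ι hι).symm.toLinearMap ∘ₗ
    (LinearMap.snd R E L ∘ₗ (LinearMap.ker q).subtype).codRestrict _ hmem
  have hπ' : ∀ y, ι (π' y) = y.1.2 := fun y =>
    congrArg Subtype.val ((LinearEquiv.ofInjective ι hι).apply_symm_apply _)
  refine ⟨ModuleCat.of R (LinearMap.ker q), β', π', (LinearMap.ker q).subtype, q, ?_, ?_, ?_,
    Submodule.subtype_injective _, LinearMap.exact_subtype_ker_map q, hq, fun b => rfl⟩
  · intro b b' h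
    exact hα (congrArg (fun y => y.1.1) h)
  · intro y
    constructor
    · intro hy
      have h2 : y.1.2 = 0 := by rw [← hπ', hy, map_zero]
      have h1 : ε y.1.1 = 0 := by
        have := LinearMap.mem_ker.mp y.2
        rw [hq', h2, map_zero, add_zero] at this
        exact (map_eq_zero_iff β hβ).mp this
      obtain ⟨b, hb⟩ := (hαε _).mp h1
      exact ⟨b, Subtype.ext (Prod.ext hb h2.symm)⟩
    · rintro ⟨b, rfl⟩
      exact (map_eq_zero_iff ι hι).mp (hπ' (β' b))
  · intro z
    obtain ⟨b, hb⟩ := (hβπ (l (ι z))).mp (by rw [hl', hιρ.apply_apply_eq_zero])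
    obtain ⟨e, rfl⟩ := hε b
    refine ⟨⟨(-e, ι z), ?_⟩, hι (hπ' _)⟩
    rw [LinearMap.mem_ker, hq', map_neg, map_neg, hb, neg_add_cancel]

theorem hasFreeSummand_of_isUnit {N : Type v} [AddCommGroup N] [Module R N] (f : N →ₗ[R] R)
    {z : N} (hz : IsUnit (f z)) : HasFreeSummand R N := by
  obtain ⟨c, hc⟩ := hz
  let w := (↑c⁻¹ : R) • z
  have hw : f w = 1 := by simp [w, ← hc]
  have hinj : Function.Injective (LinearMap.toSpanSingleton R N w) := by
    intro a b hab
    simpa [hw] using congrArg f hab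
  refine ⟨LinearMap.range (LinearMap.toSpanSingleton R N w), LinearMap.ker f, ⟨?_, ?_⟩,
    ⟨(LinearEquiv.ofInjective _ hinj).symm⟩⟩
  · rw [Submodule.disjoint_def]
    rintro _ ⟨a, rfl⟩ ha
    have : a = 0 := by simpa [hw] using ha
    simp [this]
  · rw [codisjoint_iff, eq_top_iff]
    intro x _
    refine Submodule.mem_sup.mpr ⟨f x • w, ⟨f x, rfl⟩, x - f x • w, ?_, by abel⟩
    simp [hw]

/-- If the generator of the rank one free module `B` becomes divisible by the maximal ideal in an
extension `Y` of `Z` by `B`, then the kernel of every free cover of `Z` has a free summand. -/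
theorem hasFreeSummand_of_mem_maximalIdeal_smul [IsLocalRing R] {B Y Z Z' L : Type u}
    [AddCommGroup B] [Module R B] [AddCommGroup Y] [Module R Y] [AddCommGroup Z] [Module R Z]
    [AddCommGroup Z'] [Module R Z'] [AddCommGroup L] [Module R L] [Module.Projective R L]
    {β : B →ₗ[R] Y} {π : Y →ₗ[R] Z} (hβ : Function.Injective β) (hβπ : Function.Exact β π)
    (hπ : Function.Surjective π) {ι : Z' →ₗ[R] L} {ρ : L →ₗ[R] Z} (hιρ : Function.Exact ι ρ)
    (hρ : Function.Surjective ρ) (u : B ≃ₗ[R] R)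
    (h : β (u.symm 1) ∈ maximalIdeal R • (⊤ : Submodule R Y)) : HasFreeSummand R Z' := by
  obtain ⟨l, hl⟩ := Module.projective_lifting_property π ρ hπ
  have hl' (x : L) : π (l x) = ρ x := LinearMap.congr_fun hl x
  have hmem : ∀ z : Z', (l ∘ₗ ι) z ∈ LinearMap.range β := fun z =>
    (hβπ _).mp (by rw [LinearMap.comp_apply, hl', hιρ.apply_apply_eq_zero])
  let v : Z' →ₗ[R] B := (LinearEquiv.ofInjective β hβ).symm.toLinearMap ∘ₗ
    (l ∘ₗ ι).codRestrict _ hmem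
  have hv : ∀ z, β (v z) = l (ι z) := fun z =>
    congrArg Subtype.val ((LinearEquiv.ofInjective β hβ).apply_symm_apply _)
  have hq : Function.Surjective (β.coprod l) := by
    intro y
    obtain ⟨x, hx⟩ := hρ (π y)
    obtain ⟨b, hb⟩ := (hβπ (y - l x)).mp (by rw [map_sub, hl', hx, sub_self])
    exact ⟨(b, x), by rw [LinearMap.coprod_apply, hb, sub_add_cancel]⟩
  -- Since `B × L` covers `Y`, an element of `m Y` lifts to some `(b, x) ∈ m (B × L)`; then `x`
  -- comes from `Z'`, and its image in `B ≅ R` is `1 - u b`, a unit.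
  rw [← LinearMap.range_eq_top.mpr hq, ← Submodule.map_top, ← Submodule.map_smul''] at h
  obtain ⟨⟨b, x⟩, hbx, hbx'⟩ := h
  rw [LinearMap.coprod_apply] at hbx'
  have hub : u b ∈ maximalIdeal R := by
    have : u b ∈ maximalIdeal R • (⊤ : Submodule R R) :=
      smul_top_le_comap (u.toLinearMap ∘ₗ LinearMap.fst R B L) (maximalIdeal R) hbx
    rwa [smul_eq_mul, Ideal.mul_top] at this
  have hx : l x = β (u.symm 1 - b) := by rw [map_sub, ← hbx']; abel
  obtain ⟨z, rfl⟩ := (hιρ x).mp (by rw [← hl', hx, hβπ.apply_apply_eq_zero])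
  have hvz : v z = u.symm 1 - b := hβ ((hv z).trans hx)
  refine hasFreeSummand_of_isUnit (u.toLinearMap ∘ₗ v) (z := z) ?_
  have : (u.toLinearMap ∘ₗ v) z = 1 - u b := by
    rw [LinearMap.comp_apply, hvz]
    simp
  rw [this]
  by_contra hnu
  refine (mem_maximalIdeal (1 : R)).mp ?_ isUnit_one
  simpa using add_mem ((mem_maximalIdeal _).mpr hnu) hub

end Horseshoe

end

/-! ### The iterated horseshoe and the conclusion. -/

open CategoryTheory IsLocalRing Abelian

/-- The iterated horseshoe construction: extensions of the syzygies of `Ω` by the coboundary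
modules which are themselves syzygies of the cokernel of the dual differential. -/
theorem MinimalFreeResolution.exists_extension_syz {R : Type u} [CommRing R] [IsLocalRing R]
    {I : Ideal R} (G : MinimalFreeResolution R I) {Ω : Type u} [AddCommGroup Ω] [Module R Ω]
    (L : MinimalFreeResolution R Ω) (k : ℕ)
    (hG : ∀ j < k, LinearMap.ker (G.d j).dualMap = G.coboundaries j)
    {δ : LinearMap.ker (G.d k).dualMap →ₗ[R] Ω} (hδ : Function.Surjective δ)
    (hδ0 : ∀ f, δ f = 0 ↔ f.1 ∈ G.coboundaries k) (t j : ℕ) (hjt : j + t = k) :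
    ∃ (Y C X : ModuleCat.{u} R) (β : G.coboundaries j →ₗ[R] Y) (π : Y →ₗ[R] L.syz t)
      (i : Y →ₗ[R] C) (q : C →ₗ[R] X) (φ : Module.Dual R (Fin (G.rank j) → R) →ₗ[R] C),
      Function.Injective β ∧ Function.Exact β π ∧ Function.Surjective π ∧
      Function.Injective i ∧ Function.Exact i q ∧ Function.Surjective q ∧
      Module.Free R C ∧ Module.Finite R C ∧
      IsNthSyzygy (ModuleCat.of R (Module.Dual R (Fin (G.rank (k + 1)) → R) ⧸
        LinearMap.range (G.d k).dualMap)) (t + 1) X ∧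
      ∀ b, i (β b) = φ b.1 := by
  induction t generalizing j with
  | zero =>
    obtain rfl : j = k := hjt
    refine ⟨ModuleCat.of R (LinearMap.ker (G.d j).dualMap),
      ModuleCat.of R (Module.Dual R (Fin (G.rank j) → R)),
      ModuleCat.of R (LinearMap.range (G.d j).dualMap),
      Submodule.inclusion (G.coboundaries_le_ker j), δ, Submodule.subtype _,
      (G.d j).dualMap.rangeRestrict, LinearMap.id, Submodule.inclusion_injective _, ?_, hδ,
      Submodule.subtype_injective _, ?_, LinearMap.surjective_rangeRestrict _,
      inferInstanceAs (Module.Free R (Module.Dual R (Fin (G.rank j) → R))),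
      inferInstanceAs (Module.Finite R (Module.Dual R (Fin (G.rank j) → R))), ?_, fun b => rfl⟩
    · intro f
      refine (hδ0 f).trans ⟨fun h => ⟨⟨f.1, h⟩, rfl⟩, ?_⟩
      rintro ⟨b, rfl⟩
      exact b.2
    · exact exact_rangeRestrict (LinearMap.exact_subtype_ker_map _)
    · exact ⟨_, ModuleCat.of R (Module.Dual R (Fin (G.rank (j + 1)) → R)), Submodule.subtype _,
        Submodule.mkQ _, ⟨LinearEquiv.refl R _⟩,
        inferInstanceAs (Module.Free R (Module.Dual R (Fin (G.rank (j + 1)) → R))),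
        inferInstanceAs (Module.Finite R (Module.Dual R (Fin (G.rank (j + 1)) → R))),
        Submodule.subtype_injective _, LinearMap.exact_subtype_mkQ _,
        Submodule.mkQ_surjective _⟩
  | succ t ih =>
    -- The old compatibility with `φ` is dropped: each horseshoe step supplies a new one, with `φ`
    -- the inclusion of the dual of `G_j` into the new free module, and only the last is used.
    obtain ⟨Y, C, X, β, π, i, q, φ, hβ, hβπ, hπ, hi, hiq, hq, hC, hC', hX, -⟩ :=
      ih (j + 1) (by omega)
    let ε : Module.Dual R (Fin (G.rank j) → R) →ₗ[R] G.coboundaries (j + 1) :=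
      (G.d j).dualMap.rangeRestrict
    have hε : Function.Surjective ε := LinearMap.surjective_rangeRestrict _
    have hα : Function.Exact (G.coboundaries j).subtype ε := by
      rw [← hG j (by omega)]
      exact exact_rangeRestrict (LinearMap.exact_subtype_ker_map _)
    obtain ⟨p, hp, hdp⟩ := L.exists_cover t
    obtain ⟨Y', β', π', i', q', hβ', hβπ', hπ', hi', hiq', hq', hcomm⟩ := horseshoe
      (B := G.coboundaries (j + 1)) (B' := G.coboundaries j) hβ hβπ hπ
      (Submodule.subtype_injective _) hα hε (Submodule.subtype_injective _)
      (exact_subtype_range hdp) hp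
    exact ⟨Y', ModuleCat.of R (Module.Dual R (Fin (G.rank j) → R) × (Fin (L.rank t) → R)), Y, β',
      π', i', q', LinearMap.inl R _ _, hβ', hβπ', hπ', hi', hiq', hq',
      inferInstanceAs (Module.Free R (Module.Dual R (Fin (G.rank j) → R) × (Fin (L.rank t) → R))),
      inferInstanceAs (Module.Finite R
        (Module.Dual R (Fin (G.rank j) → R) × (Fin (L.rank t) → R))),
      ⟨X, C, i, q, hX, hC, hC', hi, hiq, hq⟩, hcomm⟩

theorem mem_smul_top_dual {R : Type u} [CommRing R] {I : Ideal R} {n : ℕ}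
    (f : Module.Dual R (Fin n → R)) (hf : ∀ x, f x ∈ I) :
    f ∈ I • (⊤ : Submodule R (Module.Dual R (Fin n → R))) := by
  have h : f = ∑ l, f (Pi.single l 1) • (LinearMap.proj l : (Fin n → R) →ₗ[R] R) := by
    ext l
    simp [Finset.sum_apply, Pi.single_apply]
  rw [h]
  exact Submodule.sum_mem _ fun l _ => Submodule.smul_mem_smul (hf _) trivial

theorem hasFreeSummand_syz_of_orderIdealConjecture {R : Type u} [CommRing R]
    [IsRegularLocalRing R] (hR : OrderIdealConjecture R) (I : Ideal R) (k : ℕ)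
    (hk : I.height = (k + 1 : ℕ)) {Ω : Type u} [AddCommGroup Ω] [Module R Ω]
    (G : MinimalFreeResolution R I)
    {δ : LinearMap.ker (G.d k).dualMap →ₗ[R] Ω} (hδ : Function.Surjective δ)
    (hδ0 : ∀ f, δ f = 0 ↔ f.1 ∈ G.coboundaries k) (L : MinimalFreeResolution R Ω) :
    HasFreeSummand R (L.syz (k + 1)) := by
  have hG : ∀ j < k, LinearMap.ker (G.d j).dualMap = G.coboundaries j := by
    intro j hj
    refine le_antisymm (fun f hf => ?_) (G.coboundaries_le_ker j)
    obtain ⟨δ', -, hδ'⟩ := G.exists_ker_dualMap_to_ext j (j + 1) rfl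
    have := subsingleton_ext_quotient_of_lt_height I (i := j + 1)
      (by rw [hk]; exact_mod_cast (by omega : j + 1 < k + 1))
    exact (hδ' ⟨f, hf⟩).mp (Subsingleton.elim _ _)
  obtain ⟨Y, C, X, β, π, i, q, φ, hβ, hβπ, hπ, hi, hiq, hq, hC, hC', hX, hφ⟩ :=
    G.exists_extension_syz L k hG hδ hδ0 k 0 (zero_add k)
  have hIne : I ≠ ⊥ := by
    rintro rfl
    rw [Ideal.height_bot] at hk
    norm_cast at hk
  obtain ⟨x, hxI, hx0⟩ := Submodule.exists_mem_ne_zero_of_ne_bot hIne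
  set g : Module.Dual R (Fin (G.rank 0) → R) := I.subtype ∘ₗ G.aug with hg
  have hg0 : g ≠ 0 := by
    intro h
    obtain ⟨y, hy⟩ := G.aug_surjective ⟨x, hxI⟩
    refine hx0 ?_
    have := LinearMap.congr_fun h y
    simpa [hg, hy] using this
  -- A nonzero element of a free module over a domain spans a free module of rank one.
  let u : G.coboundaries 0 ≃ₗ[R] R := (LinearEquiv.toSpanNonzeroSingleton R _ g hg0).symm
  have hu : ((u.symm 1 : G.coboundaries 0) : Module.Dual R (Fin (G.rank 0) → R)) = g :=
    one_smul R g
  obtain ⟨p, hp, hdp⟩ := L.exists_cover k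
  refine hasFreeSummand_of_mem_maximalIdeal_smul (B := G.coboundaries 0) hβ hβπ hπ
    (exact_subtype_range hdp) hp u ?_
  by_contra hmin
  -- `Y` is a syzygy of order `k + 2 = d + 1`, while `X` has order `d`; this gap of one gives the
  -- contradiction.
  have h1 := hR.le_idealGrade_of_isNthSyzygy (Nat.succ_pos (k + 1))
    (X := Y) ⟨X, C, i, q, hX, hC, hC', hi, hiq, hq⟩ hmin
  have h2 := idealGrade_orderIdeal_le_height hk hX hi hiq hq (e := β (u.symm 1)) (by
    rw [hφ, hu]
    exact smul_top_le_comap φ I (mem_smul_top_dual g fun x => (G.aug x).2))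
  have h3 : ((k + 1 + 1 : ℕ) : ℕ∞) ≤ ((k + 1 : ℕ) : ℕ∞) := h1.trans h2
  norm_cast at h3
  omega

theorem hasFreeSummand_ext_zero (R : Type u) [CommRing R] :
    HasFreeSummand R (Ext (ModuleCat.of R (R ⧸ (⊥ : Ideal R))) (ModuleCat.of R R) 0) := by
  let e : Ext (ModuleCat.of R (R ⧸ (⊥ : Ideal R))) (ModuleCat.of R R) 0 ≃ₗ[R]
      ((R ⧸ (⊥ : Ideal R)) →ₗ[R] R) := Ext.linearEquiv₀.trans ModuleCat.homLinearEquiv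
  let z : (R ⧸ (⊥ : Ideal R)) →ₗ[R] R := (Submodule.quotEquivOfEqBot (⊥ : Ideal R) rfl).toLinearMap
  refine hasFreeSummand_of_isUnit (LinearMap.applyₗ (Submodule.Quotient.mk 1) ∘ₗ e.toLinearMap)
    (z := e.symm z) ?_
  have : (LinearMap.applyₗ (Submodule.Quotient.mk 1) ∘ₗ e.toLinearMap) (e.symm z) = (1 : R) := by
    change e (e.symm z) (Submodule.Quotient.mk 1) = 1
    rw [e.apply_symm_apply]
    rfl
  rw [this]
  exact isUnit_one

theorem hasFreeSummand_syz_ext {R : Type u} [CommRing R] [IsRegularLocalRing R]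
    (hR : OrderIdealConjecture R) (I : Ideal R) (d : ℕ) (hd : I.height = (d : ℕ∞))
    (L : MinimalFreeResolution R (Ext (ModuleCat.of R (R ⧸ I)) (ModuleCat.of R R) d)) :
    HasFreeSummand R (L.syz d) := by
  cases d with
  | zero =>
    obtain rfl : I = ⊥ := Ideal.height_eq_zero_iff_eq_bot.mp (by simpa using hd)
    exact hasFreeSummand_ext_zero R
  | succ k =>
    obtain ⟨G⟩ := MinimalFreeResolution.nonempty R I
    obtain ⟨δ, hδ, hδ0⟩ := G.exists_ker_dualMap_to_ext k (k + 1) rfl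
    exact hasFreeSummand_syz_of_orderIdealConjecture hR I k hd G hδ hδ0 L

theorem mainTheorem7 (R : Type u) [CommRing R] [IsRegularLocalRing R]
    (hR : OrderIdealConjecture R) (I : Ideal R) (d : ℕ) (hd : I.height = (d : ℕ∞))
    (L : MinimalFreeResolution R (canonicalModule I)) :
    HasFreeSummand R (L.syz d) := by
  -- `hd` makes the height finite, which excludes the unit ideal and makes `toNat` harmless.
  obtain rfl : I.height.toNat = d := by rw [hd]; rfl
  exact hasFreeSummand_syz_ext hR I _ hd L
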